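/- Let $\mathbb{F}_4$ be the field with four elements and let $R$ be one of the following three rings with $16$ elements: the Galois ring $\mathbb{G}_4=\mathbb{Z}_4[X]/(X^2+X+1)$, the ring $\mathbb{S}_4=\mathbb{F}_4[X]/(X^2)$, or the ring $\mathbb{T}_4=\mathbb{F}_4[X;a\mapsto a^2]/(X^2)$, where $\mathbb{F}_4[X;a\mapsto a^2]$ is the skew polynomial ring with the rule $Xa=a^2X$ for $a\in\mathbb{F}_4$. The right projective Hjelmslev plane $\mathrm{PHG}(2,R)$ has as points the free submodules of rank $1$ and as lines the free submodules of rank $2$ of the free right $R$-module $R^3$; a point is incident with a line if it is contained in it. A projective $(k,n)$-arc in $\mathrm{PHG}(2,R)$ is a set of $k$ points such that every line is incident with at most $n$ of them, and $\mathrm{m}_n(R)$ denotes the largest integer $k$ for which a projective $(k,n)$-arc in $\mathrm{PHG}(2,R)$ exists. Then $\mathrm{m}_5(R)\leq 68$, and in fact $\mathrm{m}_5(R)=68$. -/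

import Mathlib

open scoped Polynomial

namespace Hjelmslev

section Planes

/-- `M` is a free submodule of rank `k` of the right `R`-module `R³`
(right `R`-modules are modules over the opposite ring `Rᵐᵒᵖ`). -/
def IsFreeOfRank {R : Type*} [Ring R] (k : ℕ) (M : Submodule Rᵐᵒᵖ (Fin 3 → R)) : Prop :=
  Nonempty (Module.Basis (Fin k) Rᵐᵒᵖ M)

/-- The points of the right projective Hjelmslev plane `PHG(2, R)`:
the free rank `1` submodules of the right module `R³`. -/
abbrev Point (R : Type*) [Ring R] : Type _ :=
  {x : Submodule Rᵐᵒᵖ (Fin 3 → R) // IsFreeOfRank 1 x}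

/-- The lines of `PHG(2, R)`: the free rank `2` submodules of the right module `R³`.
A point `x` is incident with a line `L` when `x.1 ≤ L.1`. -/
abbrev Line (R : Type*) [Ring R] : Type _ :=
  {L : Submodule Rᵐᵒᵖ (Fin 3 → R) // IsFreeOfRank 2 L}

open scoped Classical in
/-- The multiplicity of a line `L` in the point set `K`: the number of points of `K` on `L`. -/
noncomputable def lineMultiplicity {R : Type*} [Ring R] (K : Finset (Point R)) (L : Line R) : ℕ :=
  (K.filter fun x => x.1 ≤ L.1).card

/-- `K` is a projective `(k, n)`-arc in `PHG(2, R)`. A projective multiset (all point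
multiplicities are `0` or `1`) is the same thing as a set of points. -/
def IsProjectiveArc {R : Type*} [Ring R] (k n : ℕ) (K : Finset (Point R)) : Prop :=
  K.card = k ∧ ∀ L : Line R, lineMultiplicity K L ≤ n

/-- `m n R` is the largest `k` such that a projective `(k, n)`-arc in `PHG(2, R)` exists. -/
noncomputable def m (n : ℕ) (R : Type*) [Ring R] : ℕ :=
  sSup {k | ∃ K : Finset (Point R), IsProjectiveArc k n K}

/-- For a finite ring the supremum defining `m n R` is a maximum. -/
theorem isGreatest_m (n : ℕ) (R : Type*) [Ring R] [Finite R] :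
    IsGreatest {k | ∃ K : Finset (Point R), IsProjectiveArc k n K} (m n R) := by
  classical
  have : Finite (Submodule Rᵐᵒᵖ (Fin 3 → R)) :=
    Finite.of_injective (fun M => (M : Set (Fin 3 → R))) SetLike.coe_injective
  have : Fintype (Point R) := Fintype.ofFinite _
  have hb : BddAbove {k | ∃ K : Finset (Point R), IsProjectiveArc k n K} := by
    refine ⟨Fintype.card (Point R), ?_⟩
    rintro k ⟨K, hK, -⟩
    exact hK ▸ K.card_le_univ
  have hne : {k | ∃ K : Finset (Point R), IsProjectiveArc k n K}.Nonempty :=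
    ⟨0, ∅, rfl, fun L => by simp [lineMultiplicity]⟩
  exact ⟨Nat.sSup_mem hne hb, fun k hk => le_csSup hb hk⟩

end Planes

section Rings

/-- The Galois ring `G₄ = ℤ₄[X]/(X² + X + 1)`. -/
abbrev G₄ : Type := AdjoinRoot (Polynomial.X ^ 2 + Polynomial.X + 1 : (ZMod 4)[X])

/-- The field `𝔽₄`. -/
abbrev F₄ : Type := GaloisField 2 2

/-- The ring `S₄ = 𝔽₄[X]/(X²)`. -/
abbrev S₄ : Type := AdjoinRoot (Polynomial.X ^ 2 : F₄[X])

/-- The action of the powers of `X` on `𝔽₄` by powers of the Frobenius map `a ↦ a²`.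
It is what makes `SkewPolynomial F₄` the skew polynomial ring `𝔽₄[X; a ↦ a²]`,
with multiplication rule `X a = a² X`. -/
noncomputable instance frobeniusAction : MulSemiringAction (Multiplicative ℕ) F₄ :=
  MulSemiringAction.compHom F₄ (powersHom (F₄ →+* F₄) (frobenius F₄ 2))

/-- The defining relation `X a = a² X` of `𝔽₄[X; a ↦ a²]`. -/
theorem X_mul_C (a : F₄) :
    (SkewPolynomial.X * SkewPolynomial.C a : SkewPolynomial F₄) =
      SkewPolynomial.C (a ^ 2) * SkewPolynomial.X := by
  have h (b : F₄) : Multiplicative.ofAdd 1 • b = b ^ 2 := rfl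
  change SkewPolynomial.monomial 1 1 * SkewPolynomial.monomial 0 a =
    SkewPolynomial.monomial 0 (a ^ 2) * SkewPolynomial.monomial 1 1
  rw [SkewPolynomial.monomial_mul_monomial, SkewPolynomial.monomial_mul_monomial]
  simp [h]

/-- The ring `T₄ = 𝔽₄[X; a ↦ a²]/(X²)`, the quotient of the skew polynomial ring by the
two-sided ideal generated by `X²`. -/
abbrev T₄ : Type :=
  (TwoSidedIdeal.span {(SkewPolynomial.X ^ 2 : SkewPolynomial F₄)}).ringCon.Quotient

end Rings

end Hjelmslev

/-! Reduction modulo the radical maps the Hjelmslev plane onto PG(2,4). Each of the 21 neighbour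
classes is an affine plane of order 4 whose five parallel classes are the line classes through it;
its affine lines are the segments. A line in class `l` meets each point class on `l` in one segment.

Upper bound. Suppose an arc has at least 69 points, and let `w` count its points in each class.
Averaging over the lines that contain a segment with `s` points in class `c`, direction `l`, gives a
bound that yields `w ≤ 4`. So the deficiencies `d = 4 - w` are nonnegative, have total at most 15,
and satisfy `4 * (s - 1) ≤ lineSum d l - d c`. Thus a segment with two points forces its line class
to be poor (deficiency at least 4), and larger segments cost more. Two points of a class always
share a segment in exactly one direction, so a full class needs 12 ordered pairs while its pencil
has deficiency at most 15: barring a line of deficiency 12, it must have exactly three poor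
directions with two double segments each. Conversely double segments obstruct each other, since a
line carrying three of them would have six points. `SegmentedArc.deficiencySystem` condenses this
into a `DeficiencySystem` on PG(2,4).

Such a system is impossible. No line has deficiency 9 or more (`DeficiencySystem.heavy_unique`,
`DeficiencySystem.lineSum_le_eight`). Hence each class with `d ≤ 1` is on exactly two rich (not
poor) lines, and counting shows that the rich lines form a dual hyperoval of six lines
(`DeficiencySystem.rich_dual_hyperoval`). The six points on no rich line then have deficiency at
least 2 each, leaving at most 3 elsewhere; the conflicts between double segments on poor lines
demand more, by a quadratic count (`DeficiencySystem.false`).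

The algebra enters only through `IsUniformizer`, a residue map onto a field whose kernel is
generated by `θ` on both sides, with `θ` annihilated on each side by exactly that kernel. All three
rings are instances with residue field of order 4.

Lower bound. For each ring an explicit list of 68 points is checked against all lines by kernel
computation, with ring elements coded by numbers below 16 (`RingCode`). Every line lies in the
annihilator of a row whose first unit entry is 1, so only those rows need checking. -/

namespace Hjelmslev

/-! ### Counting in finite projective planes. -/

section ProjectivePlane

open Configuration Finset
open scoped Classical

/-- The finite set of points on a line. -/
noncomputable def pts (P : Type*) {L : Type*} [Membership P L] [Fintype P] (l : L) : Finset P :=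
  univ.filter (· ∈ l)

/-- The finite set of lines through a point. -/
noncomputable def lns {P : Type*} (L : Type*) [Membership P L] [Fintype L] (p : P) : Finset L :=
  univ.filter (p ∈ ·)

@[simp] theorem mem_pts {P L : Type*} [Membership P L] [Fintype P] {p : P} {l : L} :
    p ∈ pts P l ↔ p ∈ l := by simp [pts]

@[simp] theorem mem_lns {P L : Type*} [Membership P L] [Fintype L] {p : P} {l : L} :
    l ∈ lns L p ↔ p ∈ l := by simp [lns]

variable {P L : Type*} [Membership P L] [ProjectivePlane P L] [Fintype P] [Fintype L]

theorem card_pts (l : L) : (pts P l).card = ProjectivePlane.order P L + 1 := by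
  rw [← ProjectivePlane.pointCount_eq P l, pointCount, Nat.card_eq_fintype_card,
    Fintype.card_subtype, pts]

theorem card_lns (p : P) : (lns L p).card = ProjectivePlane.order P L + 1 := by
  rw [← ProjectivePlane.lineCount_eq L p, lineCount, Nat.card_eq_fintype_card,
    Fintype.card_subtype, lns]

omit [Fintype P] in
theorem card_lns_inter {p q : P} (h : p ≠ q) : ((lns L p).filter (q ∈ ·)).card = 1 := by
  obtain ⟨l, hl, hu⟩ := HasLines.existsUnique_line P L p q h
  rw [card_eq_one]
  refine ⟨l, ?_⟩
  ext m
  simp only [mem_filter, mem_lns, mem_singleton]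
  exact ⟨fun hm => hu m hm, fun hm => hm ▸ hl⟩

omit [Fintype L] in
theorem card_pts_inter {l m : L} (h : l ≠ m) : ((pts P l).filter (· ∈ m)).card = 1 := by
  obtain ⟨p, hp, hu⟩ := HasPoints.existsUnique_point P L l m h
  rw [card_eq_one]
  refine ⟨p, ?_⟩
  ext q
  simp only [mem_filter, mem_pts, mem_singleton]
  exact ⟨fun hq => hu q hq, fun hq => hq ▸ hp⟩

/-- Summing over the pencil of lines through `p` counts `p` on every line of the pencil and
every other point once. -/
theorem sum_pencil (p : P) (f : P → ℕ) :
    ∑ l ∈ lns L p, ∑ q ∈ pts P l, f q = ProjectivePlane.order P L * f p + ∑ q, f q := by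
  have h1 : ∀ l ∈ lns L p, ∑ q ∈ pts P l, f q = ∑ q, if q ∈ l then f q else 0 := by
    intro l _
    rw [pts, sum_filter]
  rw [sum_congr rfl h1, sum_comm]
  have h2 : ∀ q : P, (∑ l ∈ lns L p, if q ∈ l then f q else 0) =
      ((lns L p).filter (q ∈ ·)).card * f q := by
    intro q
    rw [← sum_filter, sum_const, smul_eq_mul]
  simp_rw [h2]
  rw [← add_sum_erase univ _ (mem_univ p), ← add_sum_erase univ f (mem_univ p)]
  have h3 : (lns L p).filter (p ∈ ·) = lns L p := by
    ext l; simp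
  rw [h3, card_lns, sum_congr rfl (g := f)]
  · ring
  · intro q hq
    rw [card_lns_inter (ne_of_mem_erase hq).symm, one_mul]

/-- The dual of `sum_pencil`. -/
theorem sum_range (l : L) (g : L → ℕ) :
    ∑ p ∈ pts P l, ∑ m ∈ lns L p, g m = ProjectivePlane.order P L * g l + ∑ m, g m := by
  have h1 : ∀ p ∈ pts P l, ∑ m ∈ lns L p, g m = ∑ m, if p ∈ m then g m else 0 := by
    intro p _
    rw [lns, sum_filter]
  rw [sum_congr rfl h1, sum_comm]
  have h2 : ∀ m : L, (∑ p ∈ pts P l, if p ∈ m then g m else 0) =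
      ((pts P l).filter (· ∈ m)).card * g m := by
    intro m
    rw [← sum_filter, sum_const, smul_eq_mul]
  simp_rw [h2]
  rw [← add_sum_erase univ _ (mem_univ l), ← add_sum_erase univ g (mem_univ l)]
  have h3 : (pts P l).filter (· ∈ l) = pts P l := by
    ext p; simp
  rw [h3, card_pts, sum_congr rfl (g := g)]
  · ring
  · intro m hm
    rw [card_pts_inter (ne_of_mem_erase hm).symm, one_mul]

omit [ProjectivePlane P L] in
/-- Double counting of incidences. -/
theorem sum_mul_sum_lns (f : P → ℕ) (g : L → ℕ) :
    ∑ p : P, f p * ∑ m ∈ lns L p, g m = ∑ m : L, g m * ∑ p ∈ pts P m, f p := by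
  simp_rw [lns, pts, sum_filter, mul_sum]
  rw [sum_comm]
  refine sum_congr rfl fun m _ => sum_congr rfl fun p _ => ?_
  split_ifs <;> ring

end ProjectivePlane
end Hjelmslev

namespace Hjelmslev

/-! ### Deficiency systems on PG(2,4): generic points and uniqueness of a heavy line. -/

section Deficiency

open Configuration Finset
open scoped Classical

/-- The total deficiency of the points on a line. -/
noncomputable def lineSum {P L : Type*} [Membership P L] [Fintype P] (d : P → ℕ) (l : L) : ℕ :=
  ∑ q ∈ pts P l, d q

/-- The combinatorial constraints on the deficiencies `d` of the point classes and the numbers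
`b` of double segments which an arc with too many points would impose. -/
structure DeficiencySystem {P L : Type*} [Membership P L] [Fintype P]
    (d : P → ℕ) (b : P → L → ℕ) : Prop where
  total : ∑ p, d p ≤ 15
  le_four : ∀ p, d p ≤ 4
  low : ∀ p, d p ≤ 1 →
    (∃ S : Finset L, S.card = 3 ∧ ∀ l ∈ S, p ∈ l ∧ 4 + d p ≤ lineSum d l ∧ 2 ≤ d p + b p l) ∨
      ∃ l : L, p ∈ l ∧ 12 ≤ lineSum d l + 3 * d p
  two : ∀ p, d p = 2 → ∃ l : L, p ∈ l ∧ 6 ≤ lineSum d l ∧ 1 ≤ b p l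
  conflict : ∀ (p : P) (l : L), p ∈ l → 1 ≤ b p l → ∑ q ∈ (pts P l).erase p, b q l ≤ 4

/-- A point is generic if it is on exactly three lines with deficiency at least `4`, and these
account for its double segments. -/
def Generic {P L : Type*} [Membership P L] [Fintype P] [Fintype L]
    (d : P → ℕ) (b : P → L → ℕ) (p : P) : Prop :=
  ((lns L p).filter (4 ≤ lineSum d ·)).card = 3 ∧
    ∀ l : L, p ∈ l → 4 ≤ lineSum d l → 2 ≤ d p + b p l

variable {P L : Type*} [Membership P L] [ProjectivePlane P L] [Fintype P] [Fintype L]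
  {d : P → ℕ} {b : P → L → ℕ}

theorem card_pts_eq (ho : ProjectivePlane.order P L = 4) (l : L) : (pts P l).card = 5 := by
  rw [card_pts, ho]

theorem card_lns_eq (ho : ProjectivePlane.order P L = 4) (p : P) : (lns L p).card = 5 := by
  rw [card_lns, ho]

omit [ProjectivePlane P L] [Fintype L] in
theorem le_lineSum {p : P} {l : L} (h : p ∈ l) : d p ≤ lineSum d l :=
  single_le_sum (f := d) (fun _ _ => Nat.zero_le _) (mem_pts.2 h)

theorem sum_lineSum (ho : ProjectivePlane.order P L = 4) (p : P) :
    ∑ l ∈ lns L p, lineSum d l = 4 * d p + ∑ q, d q := by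
  unfold lineSum
  rw [sum_pencil, ho]

/-- A fourth poor line through `p` would bring the pencil to at least `3 * (4 + d p) + 4 + d p`, the
last term coming from the fifth line. This is `16 + 4 * d p`, but the pencil sums to at most `15 + 4
* d p`. -/
theorem generic_of (ho : ProjectivePlane.order P L = 4) (hd : ∑ p, d p ≤ 15) {p : P}
    (S : Finset L) (hS : S.card = 3)
    (h : ∀ l ∈ S, p ∈ l ∧ 4 + d p ≤ lineSum d l ∧ 2 ≤ d p + b p l) : Generic d b p := by
  have hsub : S ⊆ (lns L p).filter (4 ≤ lineSum d ·) := by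
    intro l hl
    have := h l hl
    simp only [mem_filter, mem_lns]
    exact ⟨this.1, by omega⟩
  have hSl : S ⊆ lns L p := hsub.trans (filter_subset _ _)
  have heq : (lns L p).filter (4 ≤ lineSum d ·) = S := by
    refine (Subset.antisymm hsub ?_).symm
    intro l hl
    by_contra hlS
    simp only [mem_filter] at hl
    have h1 := sum_sdiff (f := lineSum d) hSl
    have h2 : S.card • (4 + d p) ≤ ∑ l ∈ S, lineSum d l :=
      card_nsmul_le_sum _ _ _ fun l hl => (h l hl).2.1
    have hl' : l ∈ lns L p \ S := mem_sdiff.2 ⟨hl.1, hlS⟩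
    have h3 := add_sum_erase _ (lineSum d) hl'
    have h4 : ((lns L p \ S).erase l).card • d p ≤ ∑ l ∈ (lns L p \ S).erase l, lineSum d l := by
      refine card_nsmul_le_sum _ _ _ fun m hm => le_lineSum ?_
      exact mem_lns.1 (mem_sdiff.1 (mem_of_mem_erase hm)).1
    have h5 : ((lns L p \ S).erase l).card = 1 := by
      rw [card_erase_of_mem hl', card_sdiff_of_subset hSl, hS, card_lns_eq ho]
    rw [sum_lineSum ho] at h1
    rw [hS] at h2
    rw [h5] at h4
    simp only [smul_eq_mul] at h2 h4
    omega
  refine ⟨by rw [heq, hS], fun l hl hl4 => ?_⟩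
  have : l ∈ S := by
    rw [← heq]
    simp [hl, hl4]
  exact (h l this).2.2

-- Two lines overlap only in their meet, so together they overcount the total deficiency by at most
-- `d q`.
omit [Fintype L] in
theorem exists_meet_lineSum_add_le {l m : L} (h : l ≠ m) :
    ∃ q : P, q ∈ l ∧ q ∈ m ∧ lineSum d l + lineSum d m ≤ (∑ p, d p) + d q := by
  obtain ⟨q, hq⟩ := card_eq_one.1 (card_pts_inter (P := P) h)
  have hq' : q ∈ (pts P l).filter (· ∈ m) := by rw [hq]; simp
  simp only [mem_filter, mem_pts] at hq'
  refine ⟨q, hq'.1, hq'.2, ?_⟩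
  have hi : pts P l ∩ pts P m = {q} := by
    rw [← hq]
    ext x
    simp
  have := sum_union_inter (s₁ := pts P l) (s₂ := pts P m) (f := d)
  rw [hi, sum_singleton] at this
  unfold lineSum
  rw [← this]
  gcongr
  exact subset_univ _

omit [Fintype P] [Fintype L] in
theorem eq_of_mem {p q : P} {l m : L} (hpq : p ≠ q) (h1 : p ∈ l) (h2 : q ∈ l) (h3 : p ∈ m)
    (h4 : q ∈ m) : l = m :=
  (Nondegenerate.eq_or_eq h1 h2 h3 h4).resolve_left hpq

namespace DeficiencySystem

-- On a poor line a generic point with `d q ≤ 1` has at least `2 - d q` double segments, and for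
-- other points `2 - d q` vanishes. Hence the conflict condition bounds the sum.
omit [ProjectivePlane P L] in
theorem conflict_bound (H : DeficiencySystem d b) {l : L} {A : Finset P} {x : P}
    (hl : 4 ≤ lineSum d l) (hA : A ⊆ pts P l) (hx : x ∈ l) (hb : 1 ≤ b x l)
    (hg : ∀ q ∈ A, d q ≤ 1 → Generic d b q) : ∑ q ∈ A.erase x, (2 - d q) ≤ 4 := by
  refine le_trans ?_ (H.conflict x l hx hb)
  refine (sum_le_sum (g := fun q => b q l) fun q hq => ?_).trans
    (sum_le_sum_of_subset (erase_subset_erase _ hA))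
  by_cases hq1 : d q ≤ 1
  · have := (hg q (mem_of_mem_erase hq) hq1).2 l (mem_pts.1 (hA (mem_of_mem_erase hq))) hl
    omega
  · omega

/-- The alternative would be a second line of deficiency at least 12, and `9 + 12` exceeds `15 + 4`.
-/
theorem generic_of_zero_of_notMem (ho : ProjectivePlane.order P L = 4)
    (H : DeficiencySystem d b) {l : L} (hl : 9 ≤ lineSum d l) {x : P} (hx : d x = 0)
    (hxl : x ∉ l) : Generic d b x := by
  rcases H.low x (by omega) with ⟨S, hS, h⟩ | ⟨m, hm, hm12⟩
  · exact generic_of ho H.total S hS h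
  · have hne : l ≠ m := fun h => hxl (h ▸ hm)
    obtain ⟨q, -, -, hq⟩ := exists_meet_lineSum_add_le (d := d) hne
    have := H.le_four q
    have := H.total
    omega

/-- There is at most one line with deficiency at least `9`. -/
theorem heavy_unique (ho : ProjectivePlane.order P L = 4) (H : DeficiencySystem d b) {l m : L}
    (hl : 9 ≤ lineSum d l) (hm : 9 ≤ lineSum d m) : l = m := by
  by_contra hne
  obtain ⟨p, hpl, hpm, hp⟩ := exists_meet_lineSum_add_le (d := d) hne
  have hp4 := H.le_four p
  have hD := H.total
  have hpen := sum_lineSum (d := d) ho p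
  have hm' : m ∈ (lns L p).erase l := mem_erase.2 ⟨Ne.symm hne, mem_lns.2 hpm⟩
  rw [← add_sum_erase _ _ (mem_lns.2 hpl), ← add_sum_erase _ _ hm'] at hpen
  set B := ((lns L p).erase l).erase m with hB
  have hBc : B.card = 3 := by
    rw [hB, card_erase_of_mem hm', card_erase_of_mem (mem_lns.2 hpl), card_lns_eq ho]
  have hBm : ∀ k ∈ B, p ∈ k ∧ k ≠ l ∧ k ≠ m := by
    intro k hk
    simp only [hB, mem_erase, mem_lns] at hk
    exact ⟨hk.2.2, hk.2.1, hk.1⟩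
  have hoff : ∀ k ∈ B, ∀ q ∈ k, q ≠ p → q ∉ l := fun k hk q hq hqp hql =>
    (hBm k hk).2.1 (eq_of_mem hqp hq (hBm k hk).1 hql hpl)
  -- Since `18 ≤ 15 + d p`, only `d p = 4` and `d p = 3` remain.
  by_cases h4 : d p = 4
  -- The three other lines through `p` share at most `16 + 15 - 18 = 13`, so one of them carries
  -- only the 4 coming from `p`. Its other points are generic of deficiency 0 on a poor line, and
  -- any three of them give 6 > 4 double segments.
  · obtain ⟨k, hk, hk4⟩ : ∃ k ∈ B, lineSum d k ≤ 4 := by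
      by_contra! hcon
      have : B.card • 5 ≤ ∑ k ∈ B, lineSum d k := card_nsmul_le_sum _ _ _ fun k hk => hcon k hk
      rw [hBc, smul_eq_mul] at this
      omega
    have hpk := mem_pts.2 (hBm k hk).1
    have hsum : d p + ∑ q ∈ (pts P k).erase p, d q = lineSum d k := add_sum_erase _ _ hpk
    have hz : ∀ q ∈ (pts P k).erase p, d q = 0 := by
      refine sum_eq_zero_iff.1 ?_
      omega
    have hg : ∀ q ∈ (pts P k).erase p, Generic d b q := fun q hq =>
      generic_of_zero_of_notMem ho H hl (hz q hq)
        (hoff k hk q (mem_pts.1 (mem_of_mem_erase hq)) (ne_of_mem_erase hq))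
    have hc : ((pts P k).erase p).card = 4 := by rw [card_erase_of_mem hpk, card_pts_eq ho]
    obtain ⟨x, hx⟩ : ((pts P k).erase p).Nonempty := card_pos.1 (by omega)
    have hxk := mem_pts.1 (mem_of_mem_erase hx)
    have hbx := (hg x hx).2 k hxk (by omega)
    rw [hz x hx] at hbx
    have := H.conflict_bound (A := (pts P k).erase p) (by omega) (erase_subset _ _) hxk
      (by omega) (fun q hq _ => hg q hq)
    rw [sum_congr rfl (g := fun _ => 2) (fun q hq => by rw [hz q (mem_of_mem_erase hq)]),
      sum_const, card_erase_of_mem hx, hc] at this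
    norm_num at this
  -- With `d p = 3` the three other lines share at most `12 + 15 - 18 = 9`, so each carries exactly
  -- the 3 coming from `p`, and all deficiency lies on `l` and `m`.
  · have hBge : ∀ k ∈ B, 3 ≤ lineSum d k := fun k hk => by
      have := le_lineSum (d := d) (hBm k hk).1
      omega
    have hBle : ∀ k ∈ B, lineSum d k ≤ 3 := by
      intro k hk
      have h1 := add_sum_erase _ (lineSum d) hk
      have h2 : (B.erase k).card • 3 ≤ ∑ j ∈ B.erase k, lineSum d j :=
        card_nsmul_le_sum _ _ _ fun j hj => hBge j (mem_of_mem_erase hj)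
      rw [card_erase_of_mem hk, hBc, smul_eq_mul] at h2
      omega
    have hz : ∀ q : P, q ∉ l → q ∉ m → d q = 0 := by
      intro q hql hqm
      have hqp : p ≠ q := fun h => hql (h ▸ hpl)
      obtain ⟨k, hk, -⟩ := HasLines.existsUnique_line P L p q hqp
      have hkB : k ∈ B := by
        simp only [hB, mem_erase, mem_lns]
        exact ⟨fun h => hqm (h ▸ hk.2), fun h => hql (h ▸ hk.2), hk.1⟩
      have h1 : d p + ∑ q ∈ (pts P k).erase p, d q = lineSum d k :=
        add_sum_erase _ _ (mem_pts.2 hk.1)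
      have h2 : d q ≤ ∑ q ∈ (pts P k).erase p, d q :=
        single_le_sum (fun _ _ => Nat.zero_le _) (mem_erase.2 ⟨hqp.symm, mem_pts.2 hk.2⟩)
      have := hBle k hkB
      omega
    -- A third point `x` of the line `uv` is generic with `d x = 0`. Its pencil, of sum at most 15,
    -- contains three poor lines (at least 12) and the line `px` (exactly 3). So poor lines through
    -- `x` have deficiency exactly 4 and the remaining one has 0; `uv` is one of these.
    have hpair : ∀ u ∈ (pts P l).erase p, ∀ v ∈ (pts P m).erase p,
        d u + d v = 0 ∨ d u + d v = 4 := by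
      intro u hu v hv
      simp only [mem_erase, mem_pts] at hu hv
      have hvl : v ∉ l := fun h => hne (eq_of_mem hv.1 h hpl hv.2 hpm)
      have hum : u ∉ m := fun h => hne (eq_of_mem hu.1 hu.2 hpl h hpm)
      have huv : u ≠ v := fun h => hvl (h ▸ hu.2)
      obtain ⟨k, hk, -⟩ := HasLines.existsUnique_line P L u v huv
      have hkz : ∀ q ∈ k, q ≠ u → q ≠ v → q ∉ l ∧ q ∉ m := by
        intro q hq h1 h2
        exact ⟨fun h => hvl (eq_of_mem h1 hq hk.1 h hu.2 ▸ hk.2),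
          fun h => hum (eq_of_mem h2 hq hk.2 h hv.2 ▸ hk.1)⟩
      have hksum : lineSum d k = d u + d v := by
        rw [← sum_pair huv, lineSum]
        symm
        refine sum_subset ?_ fun q hq hq' => ?_
        · intro q
          simp only [mem_insert, mem_singleton, mem_pts]
          rintro (rfl | rfl)
          exacts [hk.1, hk.2]
        · simp only [mem_insert, mem_singleton, not_or] at hq'
          have := hkz q (mem_pts.1 hq) hq'.1 hq'.2
          exact hz q this.1 this.2
      obtain ⟨x, hx⟩ : (((pts P k).erase u).erase v).Nonempty := by
        rw [← card_pos, card_erase_of_mem (mem_erase.2 ⟨huv.symm, mem_pts.2 hk.2⟩),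
          card_erase_of_mem (mem_pts.2 hk.1), card_pts_eq ho]
        norm_num
      simp only [mem_erase, mem_pts] at hx
      obtain ⟨hxl, hxm⟩ := hkz x hx.2.2 hx.2.1 hx.1
      have hxz := hz x hxl hxm
      have hg := generic_of_zero_of_notMem ho H hl hxz hxl
      have hxp : p ≠ x := fun h => hxl (h ▸ hpl)
      obtain ⟨j, hj, -⟩ := HasLines.existsUnique_line P L p x hxp
      have hjB : j ∈ B := by
        simp only [hB, mem_erase, mem_lns]
        exact ⟨fun h => hxm (h ▸ hj.2), fun h => hxl (h ▸ hj.2), hj.1⟩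
      have hj3 := hBle j hjB
      have hj3' := hBge j hjB
      have hkj : k ≠ j := by
        rintro rfl
        exact (hBm k hjB).2.1 (eq_of_mem hu.1 hk.1 hj.1 hu.2 hpl)
      have hxpen := sum_lineSum (d := d) ho x
      rw [← sum_filter_add_sum_filter_not _ (4 ≤ lineSum d ·)] at hxpen
      have h3 := card_nsmul_le_sum ((lns L x).filter (4 ≤ lineSum d ·)) (fun i => lineSum d i) 4
        (fun i hi => (mem_filter.1 hi).2)
      rw [hg.1, smul_eq_mul] at h3
      have hjr : j ∈ (lns L x).filter (¬ 4 ≤ lineSum d ·) :=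
        mem_filter.2 ⟨mem_lns.2 hj.2, by omega⟩
      by_cases hk4 : 4 ≤ lineSum d k
      · have hk' : k ∈ (lns L x).filter (4 ≤ lineSum d ·) :=
          mem_filter.2 ⟨mem_lns.2 hx.2.2, hk4⟩
        have h5 := add_sum_erase _ (lineSum d) hk'
        have h6 := card_nsmul_le_sum (((lns L x).filter (4 ≤ lineSum d ·)).erase k)
          (fun i => lineSum d i) 4 (fun i hi => (mem_filter.1 (mem_of_mem_erase hi)).2)
        rw [card_erase_of_mem hk', hg.1, smul_eq_mul] at h6
        have h7 := single_le_sum (f := lineSum d) (fun _ _ => Nat.zero_le _) hjr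
        omega
      · have hk' : k ∈ ((lns L x).filter (¬ 4 ≤ lineSum d ·)).erase j :=
          mem_erase.2 ⟨hkj, mem_filter.2 ⟨mem_lns.2 hx.2.2, hk4⟩⟩
        have h5 := add_sum_erase _ (lineSum d) hjr
        have h6 := single_le_sum (f := lineSum d) (fun _ _ => Nat.zero_le _) hk'
        omega
    have hl9 : d p + ∑ q ∈ (pts P l).erase p, d q = lineSum d l :=
      add_sum_erase _ _ (mem_pts.2 hpl)
    have hm9 : d p + ∑ q ∈ (pts P m).erase p, d q = lineSum d m :=
      add_sum_erase _ _ (mem_pts.2 hpm)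
    obtain ⟨v, hv, hv0⟩ : ∃ v ∈ (pts P m).erase p, d v ≠ 0 := by
      by_contra! hcon
      rw [sum_eq_zero hcon] at hm9
      omega
    -- The four points of `l` other than `p` have equal deficiency, but their sum is `9 - 3 = 6`,
    -- not divisible by 4.
    have hconst : ∀ u ∈ (pts P l).erase p, d u = 4 - d v := by
      intro u hu
      have := hpair u hu v hv
      omega
    rw [sum_congr rfl hconst, sum_const, card_erase_of_mem (mem_pts.2 hpl), card_pts_eq ho,
      smul_eq_mul] at hl9
    omega

end DeficiencySystem

end Deficiency
end Hjelmslev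

namespace Hjelmslev

/-! ### No line has deficiency at least 9. -/

section Deficiency

open Configuration Finset
open scoped Classical

variable {P L : Type*} [Membership P L] [ProjectivePlane P L] [Fintype P] [Fintype L]
  {d : P → ℕ} {b : P → L → ℕ}

theorem card_points_eq (ho : ProjectivePlane.order P L = 4) : Fintype.card P = 21 := by
  rw [ProjectivePlane.card_points P L, ho]
  rfl

theorem card_off_eq_four (ho : ProjectivePlane.order P L = 4) {k l : L} (h : k ≠ l) :
    ((pts P k).filter (· ∉ l)).card = 4 := by
  have h1 := card_filter_add_card_filter_not (s := pts P k) (· ∈ l)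
  rw [card_pts_inter h, card_pts_eq ho] at h1
  omega

namespace DeficiencySystem

/-- A heavy line leaves deficiency at most 6 for the 16 points off it, so at least 10 of these have
deficiency 0. Counting those along pencils forces 13 of them and three points of deficiency at least
2, each line that joins the two kinds having exactly 3 of the former. Since 3 does not divide 13,
this is impossible. -/
theorem lineSum_le_eight (ho : ProjectivePlane.order P L = 4) (H : DeficiencySystem d b)
    (l : L) : lineSum d l ≤ 8 := by
  by_contra! hl
  have hgen : ∀ x, x ∉ l → d x ≤ 1 → Generic d b x := by
    intro x hxl hx
    rcases H.low x hx with ⟨S, hS, h⟩ | ⟨m, hm, hm12⟩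
    · exact generic_of ho H.total S hS h
    · have hlm : l = m := H.heavy_unique ho hl (by omega)
      exact absurd (hlm ▸ hm) hxl
  -- Off `l`, `f` marks the zero points (`d = 0`) and `g` the high points (`2 ≤ d`); `zs` and `hs`
  -- count them on a line.
  set f : P → ℕ := fun q => if q ∉ l ∧ d q = 0 then 1 else 0 with hf
  set g : P → ℕ := fun q => if q ∉ l ∧ 2 ≤ d q then 1 else 0 with hg
  set zs : L → ℕ := fun k => ∑ q ∈ pts P k, f q with hzs
  set hs : L → ℕ := fun k => ∑ q ∈ pts P k, g q with hhs
  have htot : lineSum d l + ∑ q ∈ univ.filter (· ∉ l), d q = ∑ q, d q := by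
    rw [lineSum, pts, sum_filter_add_sum_filter_not]
  have hfs : ∀ s : Finset P, ∑ q ∈ s.filter (· ∉ l), f q = ∑ q ∈ s, f q := by
    intro s
    refine sum_subset (filter_subset _ _) fun q hq hq' => ?_
    simp only [mem_filter, not_and, not_not] at hq'
    simp [hf, hq' hq]
  have hgs : ∀ s : Finset P, ∑ q ∈ s.filter (· ∉ l), g q = ∑ q ∈ s, g q := by
    intro s
    refine sum_subset (filter_subset _ _) fun q hq hq' => ?_
    simp only [mem_filter, not_and, not_not] at hq'
    simp [hg, hq' hq]
  have hAc : (univ.filter (fun q : P => q ∉ l)).card = 16 := by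
    have h1 := card_filter_add_card_filter_not (s := (univ : Finset P)) (· ∈ l)
    have h2 := card_pts_eq (P := P) ho l
    rw [pts] at h2
    rw [h2, card_univ, card_points_eq ho] at h1
    omega
  have h1 : 16 + ∑ q, g q ≤ ∑ q ∈ univ.filter (· ∉ l), d q + ∑ q, f q := by
    rw [← hfs, ← hgs, ← hAc, card_eq_sum_ones, ← sum_add_distrib, ← sum_add_distrib]
    refine sum_le_sum fun q hq => ?_
    simp only [mem_filter, mem_univ, true_and] at hq
    simp only [hf, hg, hq, not_false_eq_true, true_and]
    split_ifs <;> omega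
  have h2 : 2 * ∑ q, g q ≤ ∑ q ∈ univ.filter (· ∉ l), d q := by
    rw [← hgs, mul_sum]
    refine sum_le_sum fun q hq => ?_
    simp only [hg]
    split_ifs <;> omega
  have hD := H.total
  have hzh : ∀ k, k ≠ l → zs k + hs k ≤ 4 := by
    intro k hk
    rw [← card_off_eq_four (P := P) ho hk, hzs, hhs]
    simp only
    rw [← hfs, ← hgs, ← sum_add_distrib, card_eq_sum_ones]
    refine sum_le_sum fun q hq => ?_
    simp only [hf, hg]
    split_ifs <;> omega
  -- On a poor line the conflict at `x` allows at most two further zero points. Without a high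
  -- point, there is a point with `d = 1`, since otherwise all four points off `l` would be zero
  -- points; the conflict at that point then allows only one zero point.
  have hpoor : ∀ k, 4 ≤ lineSum d k → ∀ x ∈ k, x ∉ l → d x = 0 →
      zs k ≤ 3 ∧ zs k ≤ 1 + 2 * hs k := by
    intro k hk x hxk hxl hx
    have hkl : k ≠ l := fun h => hxl (h ▸ hxk)
    set A := (pts P k).filter (· ∉ l) with hA
    have hAk : A ⊆ pts P k := filter_subset _ _
    have hAl : ∀ q ∈ A, q ∉ l := fun q hq => (mem_filter.1 hq).2
    have hAg : ∀ q ∈ A, d q ≤ 1 → Generic d b q := fun q hq => hgen q (hAl q hq)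
    have hxA : x ∈ A := mem_filter.2 ⟨mem_pts.2 hxk, hxl⟩
    have hAc4 : A.card = 4 := card_off_eq_four ho hkl
    have hzA : ∑ q ∈ A, f q = zs k := hfs _
    have hzx := add_sum_erase _ f hxA
    have hfx : f x = 1 := by simp [hf, hxl, hx]
    have hbx := (hgen x hxl (by omega)).2 k hxk hk
    have hc := H.conflict_bound hk hAk hxk (by omega) hAg
    have h3 : 2 * ∑ q ∈ A.erase x, f q ≤ ∑ q ∈ A.erase x, (2 - d q) := by
      rw [mul_sum]
      refine sum_le_sum fun q hq => ?_
      simp only [hf]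
      split_ifs <;> omega
    refine ⟨by omega, ?_⟩
    by_cases hs0 : hs k = 0
    · have hlow : ∀ q ∈ A, d q ≤ 1 := by
        intro q hq
        by_contra! hq2
        change ∑ q ∈ pts P k, g q = 0 at hs0
        rw [← hgs] at hs0
        have := sum_eq_zero_iff.1 hs0 q hq
        simp [hg, hAl q hq] at this
        omega
      by_cases hone : ∃ y ∈ A, d y = 1
      · obtain ⟨y, hy, hy1⟩ := hone
        have hyk := mem_pts.1 (hAk hy)
        have hby := (hAg y hy (by omega)).2 k hyk hk
        have hcy := H.conflict_bound hk hAk hyk (by omega) hAg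
        have hfy : f y = 0 := by simp [hf, hy1]
        have hzy := add_sum_erase _ f hy
        have h4 : (A.erase y).card + ∑ q ∈ A.erase y, f q ≤ ∑ q ∈ A.erase y, (2 - d q) := by
          rw [card_eq_sum_ones, ← sum_add_distrib]
          refine sum_le_sum fun q hq => ?_
          have := hlow q (mem_of_mem_erase hq)
          simp only [hf]
          split_ifs <;> omega
        rw [card_erase_of_mem hy, hAc4] at h4
        omega
      · exfalso
        push Not at hone
        have : ∑ q ∈ A, f q = A.card := by
          rw [card_eq_sum_ones]
          refine sum_congr rfl fun q hq => ?_
          have h5 := hlow q hq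
          have h6 := hone q hq
          have h7 := hAl q hq
          simp only [hf, h7, not_false_eq_true, true_and]
          rw [if_pos]
          omega
        omega
    · omega
  -- Let F and G be the totals of `f` and `g`, and let r count the high points on the two rich lines
  -- through `x`. The pencil gives `F + 4 ≤ (3 + 2(G - r)) + (8 - r)`, while `F ≥ 10 + G` and `G ≤
  -- 3`. Equality must hold throughout.
  have hkey : ∀ x, x ∉ l → d x = 0 →
      (∑ q, g q = 3 ∧ ∑ q, f q = 13) ∧ ∀ k, x ∈ k → 1 ≤ hs k → zs k = 3 := by
    intro x hxl hx
    have hgx := hgen x hxl (by omega)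
    have hkl : ∀ k, x ∈ k → k ≠ l := fun k hk h => hxl (h ▸ hk)
    have hfx : f x = 1 := by simp [hf, hxl, hx]
    have hgx0 : g x = 0 := by simp [hg, hx]
    have pf := sum_pencil (L := L) x f
    have pg := sum_pencil (L := L) x g
    rw [ho, hfx] at pf
    rw [ho, hgx0] at pg
    have hc := card_filter_add_card_filter_not (s := lns L x) (4 ≤ lineSum d ·)
    rw [hgx.1, card_lns_eq ho] at hc
    rw [← sum_filter_add_sum_filter_not _ (4 ≤ lineSum d ·)] at pf pg
    have hr : ∑ k ∈ (lns L x).filter (¬ 4 ≤ lineSum d ·), zs k +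
        ∑ k ∈ (lns L x).filter (¬ 4 ≤ lineSum d ·), hs k ≤
        ((lns L x).filter (¬ 4 ≤ lineSum d ·)).card • 4 := by
      rw [← sum_add_distrib]
      refine sum_le_card_nsmul _ _ _ fun k hk => hzh k (hkl k ?_)
      exact mem_lns.1 (mem_filter.1 hk).1
    have hpl : ∀ k ∈ (lns L x).filter (4 ≤ lineSum d ·), zs k ≤ 1 + 2 * hs k := fun k hk =>
      (hpoor k (mem_filter.1 hk).2 x (mem_lns.1 (mem_filter.1 hk).1) hxl hx).2
    have hps : ∑ k ∈ (lns L x).filter (4 ≤ lineSum d ·), (1 + 2 * hs k) =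
        3 + 2 * ∑ k ∈ (lns L x).filter (4 ≤ lineSum d ·), hs k := by
      rw [sum_add_distrib, ← mul_sum, ← card_eq_sum_ones, hgx.1]
    have hp := sum_le_sum hpl
    rw [hps] at hp
    rw [smul_eq_mul] at hr
    change _ + _ = _ at pf pg
    change (∑ k ∈ (lns L x).filter (4 ≤ lineSum d ·), zs k) +
      (∑ k ∈ (lns L x).filter (¬ 4 ≤ lineSum d ·), zs k) = _ at pf
    change (∑ k ∈ (lns L x).filter (4 ≤ lineSum d ·), hs k) +
      (∑ k ∈ (lns L x).filter (¬ 4 ≤ lineSum d ·), hs k) = _ at pg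
    refine ⟨by omega, fun k hk hk1 => ?_⟩
    have hk4 : 4 ≤ lineSum d k := by
      by_contra hk4
      have := single_le_sum (f := hs) (fun _ _ => Nat.zero_le _)
        (mem_filter.2 ⟨mem_lns.2 hk, hk4⟩ : k ∈ (lns L x).filter (¬ 4 ≤ lineSum d ·))
      omega
    have hk3 := (hpoor k hk4 x hk hxl hx).1
    by_contra hne
    have := sum_lt_sum hpl ⟨k, mem_filter.2 ⟨mem_lns.2 hk, hk4⟩, by omega⟩
    rw [hps] at this
    omega
  obtain ⟨x, -, hx⟩ : ∃ x ∈ univ, f x ≠ 0 := by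
    by_contra! hcon
    rw [sum_eq_zero hcon] at h1
    omega
  have hx' : x ∉ l ∧ d x = 0 := by
    simpa [hf] using hx
  obtain ⟨⟨hg3, hf13⟩, -⟩ := hkey x hx'.1 hx'.2
  obtain ⟨y, -, hy⟩ : ∃ y ∈ univ, g y ≠ 0 := by
    by_contra! hcon
    rw [sum_eq_zero hcon] at hg3
    omega
  have hy' : y ∉ l ∧ 2 ≤ d y := by
    by_contra hcon
    exact hy (if_neg hcon)
  have hfy : f y = 0 := by
    simp only [hf]
    rw [if_neg]
    omega
  have py := sum_pencil (L := L) y f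
  rw [ho, hfy, hf13] at py
  -- Each line through the high point `y` has 0 or 3 zero points, and together these lines cover all
  -- 13.
  have hdvd : 3 ∣ ∑ k ∈ lns L y, ∑ q ∈ pts P k, f q := by
    refine dvd_sum fun k hk => ?_
    by_cases hz : zs k = 0
    · change 3 ∣ zs k
      rw [hz]
      exact dvd_zero 3
    · obtain ⟨q, hq, hq0⟩ := exists_ne_zero_of_sum_ne_zero hz
      have hq' : q ∉ l ∧ d q = 0 := by
        simpa [hf] using hq0
      have hh : 1 ≤ hs k := by
        have := single_le_sum (f := g) (fun _ _ => Nat.zero_le _) (mem_pts.2 (mem_lns.1 hk))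
        change g y ≤ hs k at this
        omega
      have := (hkey q hq'.1 hq'.2).2 k (mem_pts.1 hq) hh
      change 3 ∣ zs k
      rw [this]
  omega

end DeficiencySystem

end Deficiency
end Hjelmslev

namespace Hjelmslev

/-! ### The dual hyperoval of rich lines and the final contradiction. -/

section Deficiency

open Configuration Finset
open scoped Classical

variable {P L : Type*} [Membership P L] [ProjectivePlane P L] [Fintype P] [Fintype L]
  {d : P → ℕ} {b : P → L → ℕ}

/-- The number of lines with deficiency at most `3` through a point. -/
noncomputable def richDegree {P : Type*} (L : Type*) [Membership P L] [Fintype P] [Fintype L]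
    (d : P → ℕ) (p : P) : ℕ :=
  ∑ m ∈ lns L p, if 4 ≤ lineSum d m then 0 else 1

namespace DeficiencySystem

theorem generic (ho : ProjectivePlane.order P L = 4) (H : DeficiencySystem d b) {x : P}
    (hx : d x ≤ 1) : Generic d b x := by
  rcases H.low x hx with ⟨S, hS, h⟩ | ⟨m, hm, hm12⟩
  · exact generic_of ho H.total S hS h
  · have := H.lineSum_le_eight ho m
    omega

/-- Of the five lines through a generic point exactly three are poor. -/
theorem richDegree_of_le_one (ho : ProjectivePlane.order P L = 4) (H : DeficiencySystem d b)
    {x : P} (hx : d x ≤ 1) : richDegree L d x = 2 := by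
  have hc := card_filter_add_card_filter_not (s := lns L x) (4 ≤ lineSum d ·)
  rw [(H.generic ho hx).1, card_lns_eq ho] at hc
  have : richDegree L d x = ((lns L x).filter (¬ 4 ≤ lineSum d ·)).card := by
    rw [card_filter, richDegree]
    refine sum_congr rfl fun m _ => ?_
    split_ifs <;> rfl
  omega

omit [ProjectivePlane P L] in
theorem exists_rich_of_richDegree_ne_zero {x : P} (hx : richDegree L d x ≠ 0) :
    ∃ l : L, x ∈ l ∧ lineSum d l ≤ 3 := by
  obtain ⟨l, hl, h⟩ := exists_ne_zero_of_sum_ne_zero hx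
  refine ⟨l, mem_lns.1 hl, ?_⟩
  split_ifs at h <;> omega

/-- The lines with deficiency at most `3` form a dual hyperoval. -/
theorem rich_dual_hyperoval (ho : ProjectivePlane.order P L = 4) (H : DeficiencySystem d b) :
    (∑ l : L, if 4 ≤ lineSum d l then 0 else 1) = 6 ∧
      ∀ p : P, richDegree L d p = 0 ∨ richDegree L d p = 2 := by
  set R : L → ℕ := fun l => if 4 ≤ lineSum d l then 0 else 1 with hR
  set r := ∑ l, R l with hr
  set rho := richDegree L d with hrho
  set g : P → ℕ := fun q => if 2 ≤ d q then 1 else 0 with hg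
  set hs : L → ℕ := fun k => ∑ q ∈ pts P k, g q with hhs
  have hlow : ∀ x, d x ≤ 1 → rho x = 2 := fun x hx => H.richDegree_of_le_one ho hx
  have hline : ∀ l : L, ∑ p ∈ pts P l, rho p = 4 * R l + r := by
    intro l
    have := sum_range l R
    rw [ho] at this
    exact this
  have hRrich : ∀ l, lineSum d l ≤ 3 → R l = 1 := fun l hl => if_neg (by omega)
  have hs2 : ∀ l, 2 * hs l ≤ lineSum d l := by
    intro l
    rw [hhs, lineSum, mul_sum]
    refine sum_le_sum fun q _ => ?_
    simp only [hg]
    split_ifs <;> omega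
  -- Sum of rich degrees along a rich line: each of its `5 - hs l` low points contributes 2.
  have hrl : ∀ l : L, lineSum d l ≤ 3 →
      ∑ p ∈ pts P l, g p * rho p + 2 * (5 - hs l) = 4 + r := by
    intro l hl
    have h1 := hline l
    rw [hRrich l hl] at h1
    have h2 : ∑ p ∈ pts P l, (1 - g p) + hs l = 5 := by
      rw [hhs, ← sum_add_distrib, ← card_pts_eq (P := P) ho l, card_eq_sum_ones]
      refine sum_congr rfl fun q _ => ?_
      simp only [hg]
      split_ifs <;> rfl
    have h3 : ∑ p ∈ pts P l, rho p = ∑ p ∈ pts P l, g p * rho p +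
        2 * ∑ p ∈ pts P l, (1 - g p) := by
      rw [mul_sum, ← sum_add_distrib]
      refine sum_congr rfl fun q _ => ?_
      by_cases hq : 2 ≤ d q
      · simp [hg, hq]
      · simp [hg, hq, hlow q (by omega)]
    omega
  -- A rich line has at most one high point, because `2 * hs l ≤ 3`. If one has none, its degree sum
  -- is `10 = 4 + r`, so `r = 6`; a high point on a rich line then has degree `10 - 8 = 2`.
  by_cases hall : ∃ l : L, lineSum d l ≤ 3 ∧ hs l = 0
  · obtain ⟨l, hl, hl0⟩ := hall
    have h1 := hrl l hl
    have h2 : ∑ p ∈ pts P l, g p * rho p = 0 := by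
      refine sum_eq_zero fun p hp => ?_
      rw [sum_eq_zero_iff.1 hl0 p hp, zero_mul]
    refine ⟨by omega, fun p => ?_⟩
    by_contra! hp
    obtain ⟨m, hpm, hm⟩ := exists_rich_of_richDegree_ne_zero hp.1
    have hdp : 2 ≤ d p := by
      by_contra hcon
      exact hp.2 (hlow p (by omega))
    have hgp : g p = 1 := if_pos hdp
    have h3 := hrl m hm
    have h4 := hs2 m
    have h5 := add_sum_erase _ g (mem_pts.2 hpm)
    change _ = hs m at h5
    have h6 : ∑ q ∈ (pts P m).erase p, g q = 0 := by omega
    have h7 : ∑ q ∈ (pts P m).erase p, g q * rho q = 0 := by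
      refine sum_eq_zero fun q hq => ?_
      rw [sum_eq_zero_iff.1 h6 q hq, zero_mul]
    have h8 := add_sum_erase _ (fun q => g q * rho q) (mem_pts.2 hpm)
    simp only [hgp, one_mul] at h8
    have hp2 : rho p ≠ 2 := hp.2
    omega
  · exfalso
    push Not at hall
    have hone : ∀ l, lineSum d l ≤ 3 → hs l = 1 := by
      intro l hl
      have := hall l hl
      have := hs2 l
      omega
    -- In this case every rich line has exactly one high point, whose degree is `r - 4`.
    have hhigh : ∀ p, 2 ≤ d p → rho p ≠ 0 → rho p + 4 = r := by
      intro p hdp hp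
      obtain ⟨m, hpm, hm⟩ := exists_rich_of_richDegree_ne_zero hp
      have hgp : g p = 1 := if_pos hdp
      have h3 := hrl m hm
      have h4 := hone m hm
      have h5 := add_sum_erase _ g (mem_pts.2 hpm)
      change _ = hs m at h5
      have h6 : ∑ q ∈ (pts P m).erase p, g q = 0 := by omega
      have h7 : ∑ q ∈ (pts P m).erase p, g q * rho q = 0 := by
        refine sum_eq_zero fun q hq => ?_
        rw [sum_eq_zero_iff.1 h6 q hq, zero_mul]
      have h8 := add_sum_erase _ (fun q => g q * rho q) (mem_pts.2 hpm)
      simp only [hgp, one_mul] at h8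
      omega
    have hgr : ∑ p, g p * rho p = r := by
      have := sum_mul_sum_lns g R
      change ∑ p, g p * rho p = _ at this
      rw [this, hr]
      refine sum_congr rfl fun l _ => ?_
      by_cases hl : 4 ≤ lineSum d l
      · simp [hR, hl]
      · have := hone l (by omega)
        change R l * hs l = R l
        rw [this, mul_one]
    have hrr : ∑ p, rho p = 5 * r := by
      have := sum_mul_sum_lns (fun _ : P => 1) R
      simp only [one_mul, sum_const, card_pts_eq (P := P) ho, smul_eq_mul, mul_one] at this
      rw [← sum_mul, mul_comm] at this
      exact this
    have hng : ∑ p, (1 - g p) + ∑ p, g p = 21 := by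
      rw [← sum_add_distrib, ← card_points_eq (P := P) ho, ← card_univ, card_eq_sum_ones]
      refine sum_congr rfl fun q _ => ?_
      simp only [hg]
      split_ifs <;> rfl
    have hsplit : ∑ p, rho p = ∑ p, g p * rho p + 2 * ∑ p, (1 - g p) := by
      rw [mul_sum, ← sum_add_distrib]
      refine sum_congr rfl fun q _ => ?_
      by_cases hq : 2 ≤ d q
      · simp [hg, hq]
      · simp [hg, hq, hlow q (by omega)]
    have hD : 2 * ∑ p, g p ≤ ∑ p, d p := by
      rw [mul_sum]
      refine sum_le_sum fun q _ => ?_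
      simp only [hg]
      split_ifs <;> omega
    have hD15 := H.total
    set Y := univ.filter (fun p => 2 ≤ d p ∧ rho p ≠ 0) with hY
    have hYs : ∑ p, g p * rho p = Y.card * (r - 4) := by
      rw [← smul_eq_mul, ← sum_const, hY, sum_filter]
      refine sum_congr rfl fun p _ => ?_
      by_cases h1 : 2 ≤ d p
      · by_cases h2 : rho p = 0
        · simp [h2]
        · have := hhigh p h1 h2
          simp only [hg, h1, h2, ne_eq, not_false_eq_true, and_self, if_true]
          omega
      · simp [hg, h1]
    rw [hgr] at hYs
    -- Counting degrees gives `4 * r = 2 * (21 - G)`, with G the number of high points, at most 7.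
    -- Then `r = Y.card * (r - 4)` leaves only `r = 8` and `Y.card = 2`.
    have hr7 : 7 ≤ r ∧ r ≤ 10 := by omega
    have hY2 : Y.card = 2 := by
      rcases hr7 with ⟨h1, h2⟩
      clear_value r Y
      interval_cases r <;> omega
    obtain ⟨y, z, hyz, hYyz⟩ := card_eq_two.1 hY2
    have hyY : y ∈ Y := by simp [hYyz]
    have hzY : z ∈ Y := by simp [hYyz]
    have hy := (mem_filter.1 hyY).2
    have hz := (mem_filter.1 hzY).2
    obtain ⟨l, hl, -⟩ := HasLines.existsUnique_line P L y z hyz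
    -- A low point of the line `yz` is on a rich line, whose high point is `y` or `z`. That rich
    -- line would be `yz`, which has two high points. Hence all five points are high and the
    -- deficiency is at least 10.
    have hl2 : ∀ p ∈ pts P l, 2 ≤ d p := by
      intro p hp
      by_contra! hcon
      have hpy : p ≠ y := by rintro rfl; omega
      have hpz : p ≠ z := by rintro rfl; omega
      have hp0 : rho p ≠ 0 := by rw [hlow p (by omega)]; norm_num
      obtain ⟨m, hpm, hm⟩ := exists_rich_of_richDegree_ne_zero hp0
      have h1 : hs m ≠ 0 := by rw [hone m hm]; norm_num
      obtain ⟨q, hqm, hq⟩ := exists_ne_zero_of_sum_ne_zero h1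
      have hq2 : 2 ≤ d q := by
        by_contra hcon
        exact hq (if_neg hcon)
      have hqr : rho q ≠ 0 := by
        have h2 : R m ≤ rho q := single_le_sum (f := R) (fun _ _ => Nat.zero_le _)
          (mem_lns.2 (mem_pts.1 hqm))
        rw [hRrich m hm] at h2
        omega
      have hqY : q ∈ Y := mem_filter.2 ⟨mem_univ _, hq2, hqr⟩
      have hml : m = l := by
        rw [hYyz, mem_insert, mem_singleton] at hqY
        rcases hqY with rfl | rfl
        · exact eq_of_mem hpy hpm (mem_pts.1 hqm) (mem_pts.1 hp) hl.1
        · exact eq_of_mem hpz hpm (mem_pts.1 hqm) (mem_pts.1 hp) hl.2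
      subst hml
      have h3 : ∑ q ∈ {y, z}, g q ≤ hs m := by
        refine sum_le_sum_of_subset ?_
        intro q hq
        simp only [mem_insert, mem_singleton] at hq
        rcases hq with rfl | rfl
        exacts [mem_pts.2 hl.1, mem_pts.2 hl.2]
      rw [sum_pair hyz, hone m hm] at h3
      have : g y = 1 := if_pos hy.1
      have : g z = 1 := if_pos hz.1
      omega
    have h10 : (pts P l).card • 2 ≤ lineSum d l := card_nsmul_le_sum _ _ _ hl2
    rw [card_pts_eq ho, smul_eq_mul] at h10
    have h8 := H.lineSum_le_eight ho l
    omega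

/-- A system of deficiencies of total at most `15` does not exist. -/
theorem false (ho : ProjectivePlane.order P L = 4) (H : DeficiencySystem d b) : False := by
  obtain ⟨hr, hrho⟩ := H.rich_dual_hyperoval ho
  set R : L → ℕ := fun l => if 4 ≤ lineSum d l then 0 else 1 with hR
  set rho := richDegree L d with hrhodef
  have hlow : ∀ x, d x ≤ 1 → rho x = 2 := fun x hx => H.richDegree_of_le_one ho hx
  have hline : ∀ l : L, ∑ p ∈ pts P l, rho p = 4 * R l + 6 := by
    intro l
    have := sum_range l R
    rw [ho, hr] at this
    exact this
  have hrr : ∑ p, rho p = 30 := by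
    have := sum_mul_sum_lns (fun _ : P => 1) R
    simp only [one_mul, sum_const, card_pts_eq (P := P) ho, smul_eq_mul, mul_one] at this
    rw [← sum_mul, hr] at this
    exact this
  -- `O` is the hyperoval of points on no rich line. Outside it, `mu` truncates the deficiency at 2,
  -- just enough to cover the double segments missing on a poor line.
  set O := univ.filter (fun p => rho p = 0) with hO
  set O2 := O.filter (fun p => d p = 2) with hO2
  set mu : P → ℕ := fun q => if rho q = 0 then 0 else min (d q) 2 with hmu
  set ml : L → ℕ := fun l => ∑ q ∈ pts P l, mu q with hml
  set S := ∑ q, mu q with hS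
  have hcardO : 2 * O.card + ∑ p, rho p = 42 := by
    have : (42 : ℕ) = ∑ _p : P, 2 := by
      rw [sum_const, card_univ, card_points_eq ho]
      rfl
    rw [this, hO, card_filter, mul_sum, ← sum_add_distrib]
    refine sum_congr rfl fun p _ => ?_
    rcases hrho p with h | h
    · simp [h]
    · simp [h]
  have hO6 : O.card = 6 := by omega
  have hOd : ∀ p ∈ O, 2 ≤ d p := by
    intro p hp
    by_contra! hcon
    have h1 := hlow p (by omega)
    have h2 := (mem_filter.1 hp).2
    omega
  have hDsplit : ∑ p ∈ O, d p + S ≤ ∑ p, d p := by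
    rw [← sum_filter_add_sum_filter_not univ (fun p => rho p = 0) d, ← hO, hS,
      ← sum_filter_add_sum_filter_not univ (fun p => rho p = 0) mu]
    have h1 : ∑ p ∈ univ.filter (fun p => rho p = 0), mu p = 0 :=
      sum_eq_zero fun p hp => if_pos (mem_filter.1 hp).2
    rw [h1, zero_add]
    gcongr with p hp
    simp only [hmu]
    split_ifs <;> omega
  have hO2c : 18 ≤ ∑ p ∈ O, d p + O2.card := by
    have : (18 : ℕ) = ∑ _p ∈ O, 3 := by rw [sum_const, hO6]; rfl
    rw [this, hO2, card_filter, ← sum_add_distrib]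
    refine sum_le_sum fun p hp => ?_
    have := hOd p hp
    split_ifs <;> omega
  have hO12 : 12 ≤ ∑ p ∈ O, d p := by
    have := card_nsmul_le_sum _ _ _ hOd
    rw [hO6] at this
    exact this
  have hD := H.total
  have hex : ∀ x, ∃ l : L, d x = 2 → x ∈ l ∧ 6 ≤ lineSum d l ∧ 1 ≤ b x l := by
    intro x
    by_cases hx : d x = 2
    · obtain ⟨l, hl⟩ := H.two x hx
      exact ⟨l, fun _ => hl⟩
    · obtain ⟨l, -⟩ := exists_ne_zero_of_sum_ne_zero (hr ▸ (by norm_num) : (∑ l, R l) ≠ 0)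
      exact ⟨l, fun h => absurd h hx⟩
  choose lx hlx using hex
  set c : L → ℕ := fun l => (O2.filter (lx · = l)).card with hc
  have hcsum : ∑ l, c l = O2.card := by
    rw [card_eq_sum_card_fiberwise (f := lx) (t := univ) (fun _ _ => mem_coe.2 (mem_univ _))]
  -- A poor line has degree sum 6, hence three points off `O`. These have at least 6 double segments
  -- up to the correction `mu`, and the assigned points of `O2` other than `x` add `c l - 1`. The
  -- conflict at `x` allows 4, so `6 + (c l - 1) ≤ 4 + ml l`.
  have hcml : ∀ l, 1 ≤ c l → c l + 1 ≤ ml l ∧ 4 ≤ lineSum d l := by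
    intro l hcl
    obtain ⟨x, hx⟩ := card_pos.1 hcl
    obtain ⟨hxO2, hxl⟩ := mem_filter.1 hx
    obtain ⟨hxO, hx2⟩ := mem_filter.1 hxO2
    have hxl' := hlx x hx2
    rw [hxl] at hxl'
    have hl4 : 4 ≤ lineSum d l := by omega
    refine ⟨?_, hl4⟩
    have hcon := H.conflict x l hxl'.1 hxl'.2.2
    have hsub : (O2.filter (lx · = l)).erase x ⊆ (pts P l).erase x := by
      refine erase_subset_erase _ fun q hq => ?_
      obtain ⟨hq1, hq2⟩ := mem_filter.1 hq
      have := hlx q (mem_filter.1 hq1).2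
      rw [hq2] at this
      exact mem_pts.2 this.1
    have h1 : ((pts P l).erase x).filter (· ∈ (O2.filter (lx · = l)).erase x) =
        (O2.filter (lx · = l)).erase x := by
      ext q
      simp only [mem_filter]
      exact ⟨fun h => h.2, fun h => ⟨hsub h, h⟩⟩
    have h2 : ∑ q ∈ (pts P l).erase x, (if q ∈ (O2.filter (lx · = l)).erase x then 1 else 0) =
        c l - 1 := by
      rw [← card_filter, h1, card_erase_of_mem hx]
    have hmux : mu x = 0 := if_pos (mem_filter.1 hxO).2
    have hrx : rho x = 0 := (mem_filter.1 hxO).2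
    have h3 := add_sum_erase _ mu (mem_pts.2 hxl'.1)
    have h4 := add_sum_erase _ rho (mem_pts.2 hxl'.1)
    have h5 : ∑ q ∈ pts P l, rho q = 6 := by
      rw [hline l, hR]
      simp [hl4]
    have h6 : ∑ q ∈ (pts P l).erase x, rho q +
        ∑ q ∈ (pts P l).erase x, (if q ∈ (O2.filter (lx · = l)).erase x then 1 else 0) ≤
        ∑ q ∈ (pts P l).erase x, b q l + ∑ q ∈ (pts P l).erase x, mu q := by
      rw [← sum_add_distrib, ← sum_add_distrib]
      refine sum_le_sum fun q hq => ?_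
      have hql := mem_pts.1 (mem_of_mem_erase hq)
      rcases hrho q with h0 | h0
      · split_ifs with hqO
        · obtain ⟨hq1, hq2⟩ := mem_filter.1 (mem_of_mem_erase hqO)
          have := hlx q (mem_filter.1 hq1).2
          rw [hq2] at this
          omega
        · omega
      · have hqn : q ∉ (O2.filter (lx · = l)).erase x := by
          intro hqO
          have := (mem_filter.1 (mem_filter.1 (mem_filter.1 (mem_of_mem_erase hqO)).1).1).2
          omega
        rw [if_neg hqn]
        have hmq : mu q = min (d q) 2 := if_neg (by omega)
        by_cases hd1 : d q ≤ 1
        · have := (H.generic ho hd1).2 l hql hl4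
          omega
        · omega
    change _ = ml l at h3
    omega
  set Po := univ.filter (fun l : L => 4 ≤ lineSum d l) with hPo
  have hcPo : ∑ l ∈ Po, c l = O2.card := by
    rw [← hcsum]
    refine sum_subset (subset_univ _) fun l _ hl => ?_
    by_contra hcl
    exact hl (mem_filter.2 ⟨mem_univ _, (hcml l (by omega)).2⟩)
  -- If `c ≥ 1` then `ml * (ml - 1) ≥ (c + 1) * c ≥ 2 * c`.
  have hq : ∀ l ∈ Po, 2 * c l + ml l ≤ ml l * ml l := by
    intro l _
    by_cases hcl : 1 ≤ c l
    · have := (hcml l hcl).1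
      nlinarith
    · have h0 : c l = 0 := by omega
      rw [h0]
      simpa using Nat.le_mul_self (ml l)
  have hq' := sum_le_sum hq
  rw [sum_add_distrib, ← mul_sum, hcPo] at hq'
  have hR1 : ∀ q : P, ∑ m ∈ lns L q, (1 - R m) + rho q = 5 := by
    intro q
    rw [hrhodef, richDegree, ← sum_add_distrib, ← card_lns_eq (L := L) ho q, card_eq_sum_ones]
    refine sum_congr rfl fun m _ => ?_
    simp only [hR]
    split_ifs <;> rfl
  have hPoR : ∀ f : L → ℕ, ∑ l ∈ Po, f l = ∑ l, (1 - R l) * f l := by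
    intro f
    rw [hPo, sum_filter]
    refine sum_congr rfl fun l _ => ?_
    simp only [hR]
    split_ifs <;> simp
  have hmul : ∑ l ∈ Po, ml l = 3 * S := by
    rw [hPoR, ← sum_mul_sum_lns, hS, mul_sum]
    refine sum_congr rfl fun q _ => ?_
    rcases hrho q with h0 | h0
    · have : mu q = 0 := if_pos h0
      simp [this]
    · have := hR1 q
      have : ∑ m ∈ lns L q, (1 - R m) = 3 := by omega
      rw [this, mul_comm]
  -- Through a point `q` off `O` the values `ml` sum to `4 * mu q + S`, of which each of the two
  -- rich lines takes at least `mu q`.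
  have hmm : ∑ l ∈ Po, ml l * ml l ≤ ∑ q, mu q * (2 * mu q + S) := by
    rw [hPoR]
    simp_rw [← mul_assoc]
    rw [← sum_mul_sum_lns mu (fun l => (1 - R l) * ml l)]
    refine sum_le_sum fun q _ => ?_
    rcases hrho q with h0 | h0
    · have : mu q = 0 := if_pos h0
      simp [this]
    · gcongr
      have h1 := sum_pencil (L := L) q mu
      rw [ho] at h1
      have h2 : ∑ m ∈ lns L q, R m * mu q = 2 * mu q := by
        rw [← sum_mul]
        exact congrArg (· * mu q) h0
      have h3 : ∑ m ∈ lns L q, ((1 - R m) * ml m + R m * mu q) ≤ ∑ m ∈ lns L q, ml m := by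
        refine sum_le_sum fun m hm => ?_
        have : mu q ≤ ml m := single_le_sum (f := mu) (fun _ _ => Nat.zero_le _)
          (mem_pts.2 (mem_lns.1 hm))
        simp only [hR]
        split_ifs <;> simp [this]
      rw [sum_add_distrib, h2] at h3
      change ∑ m ∈ lns L q, ml m = _ at h1
      omega
  have hQ : ∑ q, mu q * (2 * mu q + S) = 2 * ∑ q, mu q * mu q + S * S := by
    rw [mul_sum, hS, sum_mul, ← sum_add_distrib]
    refine sum_congr rfl fun q _ => ?_
    ring
  set n2 := ∑ q, (if mu q = 2 then 1 else 0) with hn2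
  have hmu2 : ∀ q, mu q ≤ 2 := by
    intro q
    simp only [hmu]
    split_ifs <;> omega
  have hQ2 : ∑ q, mu q * mu q = S + 2 * n2 := by
    rw [hS, hn2, mul_sum, ← sum_add_distrib]
    refine sum_congr rfl fun q _ => ?_
    have := hmu2 q
    interval_cases mu q <;> rfl
  have hn2S : 2 * n2 ≤ S := by
    rw [hS, hn2, mul_sum]
    refine sum_le_sum fun q _ => ?_
    split_ifs <;> omega
  have hS3 : S ≤ 3 := by omega
  have hfin : 2 * O2.card + 3 * S ≤ 2 * (S + 2 * n2) + S * S := by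
    rw [← hQ2, ← hQ, ← hmul]
    exact hq'.trans hmm
  -- Here `O2.card ≥ 3 + S`, so `6 + 3 * S ≤ 4 * n2 + S * S` with `2 * n2 ≤ S ≤ 3`, which fails for
  -- each `S`.
  clear_value S n2
  interval_cases S <;> omega

end DeficiencySystem

end Deficiency
end Hjelmslev

namespace Hjelmslev

/-! ### From arcs to deficiency systems. -/

section Segments

open Configuration Finset
open scoped Classical

/-- The incidence data of an arc in a projective Hjelmslev plane of order `4` over the plane
of its neighbour classes. Every point `i` has a class `cls i` and, for every line class `l`
through its class, a segment `seg l i`. The lines in the class `l` are indexed by `T`, and the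
line indexed by `t` meets the class `c` in the segment `val t c`. -/
structure SegmentedArc {P L ι T : Type*} [Membership P L] [Fintype ι] [Fintype T]
    (cls : ι → P) (seg : L → ι → Fin 4) (val : T → P → Fin 4) : Prop where
  card_val : ∀ c c' : P, c ≠ c' → ∀ u v : Fin 4,
    (univ.filter fun t => val t c = u ∧ val t c' = v).card = 4
  exists_dir : ∀ i j, i ≠ j → cls i = cls j →
    ∃ l : L, cls i ∈ l ∧ seg l i = seg l j ∧
      ∀ m : L, cls i ∈ m → seg m i = seg m j → m = l
  card_le : ∀ (l : L) (t : T),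
    (univ.filter fun i => cls i ∈ l ∧ seg l i = val t (cls i)).card ≤ 5

/-- The number of points in a segment. -/
noncomputable def segCard {P L ι : Type*} [Fintype ι] (cls : ι → P) (seg : L → ι → Fin 4)
    (c : P) (l : L) (u : Fin 4) : ℕ :=
  (univ.filter fun i => cls i = c ∧ seg l i = u).card

/-- The number of points in a neighbour class. -/
noncomputable def clsCard {P ι : Type*} [Fintype ι] (cls : ι → P) (c : P) : ℕ :=
  (univ.filter fun i => cls i = c).card

/-- The number of segments in the class `c` and direction `l` with at least two points. -/
noncomputable def doubleCount {P L ι : Type*} [Fintype ι] (cls : ι → P) (seg : L → ι → Fin 4)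
    (c : P) (l : L) : ℕ :=
  ∑ u, if 2 ≤ segCard cls seg c l u then 1 else 0

theorem sum_segCard {P L ι : Type*} [Fintype ι] (cls : ι → P) (seg : L → ι → Fin 4) (c : P)
    (l : L) : ∑ u, segCard cls seg c l u = clsCard cls c := by
  unfold clsCard
  rw [card_eq_sum_card_fiberwise (f := seg l) (t := univ) (fun _ _ => mem_coe.2 (mem_univ _))]
  simp_rw [filter_filter]
  rfl

theorem sum_clsCard {P ι : Type*} [Fintype P] [Fintype ι] (cls : ι → P) :
    ∑ c, clsCard cls c = Fintype.card ι := by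
  rw [← card_univ,
    card_eq_sum_card_fiberwise (f := cls) (t := univ) (fun _ _ => mem_coe.2 (mem_univ _))]
  rfl

/-- The possible distributions of four points on four segments, in terms of the number of
ordered pairs of points on a common segment. -/
theorem four_on_segments : ∀ a b c e : Fin 4, a.1 + b.1 + c.1 + e.1 = 4 →
    a.1 * (a.1 - 1) + b.1 * (b.1 - 1) + c.1 * (c.1 - 1) + e.1 * (e.1 - 1) = 0 ∨
    (2 ≤ a.1 ∨ 2 ≤ b.1 ∨ 2 ≤ c.1 ∨ 2 ≤ e.1) ∧
      (a.1 * (a.1 - 1) + b.1 * (b.1 - 1) + c.1 * (c.1 - 1) + e.1 * (e.1 - 1) = 2 ∨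
      a.1 * (a.1 - 1) + b.1 * (b.1 - 1) + c.1 * (c.1 - 1) + e.1 * (e.1 - 1) = 4 ∧
        (if 2 ≤ a.1 then 1 else 0) + (if 2 ≤ b.1 then 1 else 0) + (if 2 ≤ c.1 then 1 else 0) +
          (if 2 ≤ e.1 then 1 else 0) = 2) ∨
    (3 ≤ a.1 ∨ 3 ≤ b.1 ∨ 3 ≤ c.1 ∨ 3 ≤ e.1) ∧
      a.1 * (a.1 - 1) + b.1 * (b.1 - 1) + c.1 * (c.1 - 1) + e.1 * (e.1 - 1) = 6 := by
  decide

/-- The possible distributions of three points, not all together, on four segments. -/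
theorem three_on_segments : ∀ a b c e : Fin 3, a.1 + b.1 + c.1 + e.1 = 3 →
    a.1 * (a.1 - 1) + b.1 * (b.1 - 1) + c.1 * (c.1 - 1) + e.1 * (e.1 - 1) = 0 ∨
    (2 ≤ a.1 ∨ 2 ≤ b.1 ∨ 2 ≤ c.1 ∨ 2 ≤ e.1) ∧
      a.1 * (a.1 - 1) + b.1 * (b.1 - 1) + c.1 * (c.1 - 1) + e.1 * (e.1 - 1) = 2 ∧
        (if 2 ≤ a.1 then 1 else 0) + (if 2 ≤ b.1 then 1 else 0) + (if 2 ≤ c.1 then 1 else 0) +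
          (if 2 ≤ e.1 then 1 else 0) = 1 := by
  decide

namespace SegmentedArc

variable {P L ι T : Type*} [Membership P L] [ProjectivePlane P L] [Fintype P] [Fintype L]
  [Fintype ι] [Fintype T] {cls : ι → P} {seg : L → ι → Fin 4} {val : T → P → Fin 4}

omit [ProjectivePlane P L] [Fintype P] [Fintype L] in
theorem sum_val (H : SegmentedArc cls seg val) {c c' : P} (h : c ≠ c') (u : Fin 4)
    (f : Fin 4 → ℕ) :
    ∑ t ∈ univ.filter (fun t => val t c = u), f (val t c') = 4 * ∑ v, f v := by
  rw [← sum_fiberwise_of_maps_to (t := univ) (g := fun t => val t c')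
    (fun _ _ => mem_univ _), mul_sum]
  refine sum_congr rfl fun v _ => ?_
  rw [sum_congr rfl (g := fun _ => f v), sum_const, filter_filter, H.card_val c c' h,
    smul_eq_mul]
  intro t ht
  rw [(mem_filter.1 ht).2]

theorem card_val_eq (ho : ProjectivePlane.order P L = 4) (H : SegmentedArc cls seg val)
    (c : P) (u : Fin 4) : (univ.filter fun t => val t c = u).card = 16 := by
  obtain ⟨c', hc'⟩ := Fintype.exists_ne_of_one_lt_card
    (by rw [card_points_eq (P := P) ho]; norm_num) c
  have := H.sum_val hc'.symm u fun _ => 1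
  simpa using this

omit [ProjectivePlane P L] [Fintype L] in
/-- The number of points of the arc on a line is the sum over its segments. -/
theorem sum_segCard_le (H : SegmentedArc cls seg val) (l : L) (t : T) :
    ∑ c ∈ pts P l, segCard cls seg c l (val t c) ≤ 5 := by
  refine le_trans (le_of_eq ?_) (H.card_le l t)
  rw [card_eq_sum_card_fiberwise (f := cls) (t := pts P l)
    (fun i hi => mem_coe.2 (mem_pts.2 (mem_filter.1 (mem_coe.1 hi)).2.1))]
  refine sum_congr rfl fun c hc => ?_
  rw [filter_filter]
  unfold segCard
  congr 1
  ext i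
  simp only [mem_filter, mem_univ, true_and]
  constructor
  · rintro ⟨rfl, h⟩
    exact ⟨⟨mem_pts.1 hc, h⟩, rfl⟩
  · rintro ⟨⟨_, h⟩, rfl⟩
    exact ⟨rfl, h⟩

/-- Average the arc bound over the 16 indices `t` whose lines contain the given segment. Each of
these lines has the segment in common, while every segment of another class on `l` occurs four
times. -/
theorem sum_clsCard_add_le (ho : ProjectivePlane.order P L = 4) (H : SegmentedArc cls seg val)
    {c : P} {l : L} (hc : c ∈ l) (u : Fin 4) :
    ∑ c' ∈ pts P l, clsCard cls c' + 4 * segCard cls seg c l u ≤ 20 + clsCard cls c := by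
  have h1 : ∑ t ∈ univ.filter (fun t => val t c = u),
      ∑ c' ∈ pts P l, segCard cls seg c' l (val t c') ≤ 16 • 5 := by
    rw [← H.card_val_eq ho c u]
    exact sum_le_card_nsmul _ _ _ fun t _ => H.sum_segCard_le l t
  rw [sum_comm, ← add_sum_erase _ _ (mem_pts.2 hc)] at h1
  have h2 : ∑ t ∈ univ.filter (fun t => val t c = u), segCard cls seg c l (val t c) =
      16 * segCard cls seg c l u := by
    rw [sum_congr rfl (g := fun _ => segCard cls seg c l u), sum_const, H.card_val_eq ho,
      smul_eq_mul]
    intro t ht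
    rw [(mem_filter.1 ht).2]
  have h3 : ∑ c' ∈ (pts P l).erase c, ∑ t ∈ univ.filter (fun t => val t c = u),
      segCard cls seg c' l (val t c') = 4 * ∑ c' ∈ (pts P l).erase c, clsCard cls c' := by
    rw [mul_sum]
    refine sum_congr rfl fun c' hc' => ?_
    rw [H.sum_val (ne_of_mem_erase hc').symm, sum_segCard]
  rw [h2, h3] at h1
  have h4 := add_sum_erase _ (clsCard cls) (mem_pts.2 hc)
  simp only [smul_eq_mul] at h1
  omega

/-- A line through a double segment of `c` can carry only one more, as three would give six points.
Of the 16 indices through that segment, four go to each segment of another class, so at most four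
segments there are double. -/
theorem sum_doubleCount_le (ho : ProjectivePlane.order P L = 4) (H : SegmentedArc cls seg val)
    {c : P} {l : L} (hc : c ∈ l) (hb : 1 ≤ doubleCount cls seg c l) :
    ∑ c' ∈ (pts P l).erase c, doubleCount cls seg c' l ≤ 4 := by
  obtain ⟨u, -, hu⟩ := exists_ne_zero_of_sum_ne_zero (Nat.one_le_iff_ne_zero.1 hb)
  have hu2 : 2 ≤ segCard cls seg c l u := by
    by_contra hcon
    exact hu (if_neg hcon)
  have h1 : ∑ t ∈ univ.filter (fun t => val t c = u), ∑ c' ∈ (pts P l).erase c,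
      (if 2 ≤ segCard cls seg c' l (val t c') then 1 else 0) ≤ 16 • 1 := by
    rw [← H.card_val_eq ho c u]
    refine sum_le_card_nsmul _ _ _ fun t ht => ?_
    have h2 := H.sum_segCard_le l t
    rw [← add_sum_erase _ _ (mem_pts.2 hc), (mem_filter.1 ht).2] at h2
    have h3 : 2 * ∑ c' ∈ (pts P l).erase c,
        (if 2 ≤ segCard cls seg c' l (val t c') then 1 else 0) ≤
        ∑ c' ∈ (pts P l).erase c, segCard cls seg c' l (val t c') := by
      rw [mul_sum]
      refine sum_le_sum fun c' _ => ?_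
      split_ifs <;> omega
    omega
  rw [sum_comm] at h1
  have h3 : ∑ c' ∈ (pts P l).erase c, ∑ t ∈ univ.filter (fun t => val t c = u),
      (if 2 ≤ segCard cls seg c' l (val t c') then 1 else 0) =
      4 * ∑ c' ∈ (pts P l).erase c, doubleCount cls seg c' l := by
    rw [mul_sum]
    refine sum_congr rfl fun c' hc' => ?_
    exact H.sum_val (ne_of_mem_erase hc').symm u
      fun v => if 2 ≤ segCard cls seg c' l v then 1 else 0
  rw [h3] at h1
  simp only [smul_eq_mul] at h1
  omega

omit [ProjectivePlane P L] [Fintype P] in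
/-- Two points of the same class are on a common segment in exactly one direction. -/
theorem sum_pairs (H : SegmentedArc cls seg val) (c : P) :
    ∑ l ∈ lns L c, ∑ u, segCard cls seg c l u * (segCard cls seg c l u - 1) =
      clsCard cls c * (clsCard cls c - 1) := by
  set I := univ.filter fun i => cls i = c with hI
  have hImem : ∀ i, i ∈ I ↔ cls i = c := fun i => by simp [hI]
  have h1 : ∀ l : L, ∑ u, segCard cls seg c l u * (segCard cls seg c l u - 1) =
      (I.offDiag.filter fun x => seg l x.1 = seg l x.2).card := by
    intro l
    rw [card_eq_sum_card_fiberwise (f := fun x => seg l x.1) (t := univ)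
      (fun _ _ => mem_coe.2 (mem_univ _))]
    refine sum_congr rfl fun u _ => ?_
    unfold segCard
    rw [Nat.mul_sub_one, ← offDiag_card]
    congr 1
    ext ⟨i, j⟩
    simp only [mem_filter, mem_offDiag, mem_univ, true_and, hImem]
    constructor
    · rintro ⟨⟨h1, h2⟩, ⟨h3, h4⟩, h5⟩
      exact ⟨⟨⟨h1, h3, h5⟩, h2.trans h4.symm⟩, h2⟩
    · rintro ⟨⟨⟨h1, h3, h5⟩, h2⟩, h4⟩
      exact ⟨⟨h1, h4⟩, ⟨h3, h2 ▸ h4⟩, h5⟩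
  have h2 : ∀ x ∈ I.offDiag, ((lns L c).filter fun l => seg l x.1 = seg l x.2).card = 1 := by
    rintro ⟨i, j⟩ hx
    simp only [mem_offDiag, hImem] at hx
    obtain ⟨l, hl, hs, hu⟩ := H.exists_dir i j hx.2.2 (hx.1.trans hx.2.1.symm)
    rw [hx.1] at hl hu
    rw [card_eq_one]
    refine ⟨l, ?_⟩
    ext m
    simp only [mem_filter, mem_lns, mem_singleton]
    exact ⟨fun h => hu m h.1 h.2, fun h => h ▸ ⟨hl, hs⟩⟩
  simp_rw [h1, card_filter]
  rw [sum_comm]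
  simp_rw [← card_filter]
  rw [sum_congr rfl h2, ← card_eq_sum_ones, offDiag_card, Nat.mul_sub_one]
  rfl

/-- In every direction some segment holds at least `⌈w / 4⌉` of the `w` points. Summing
`sum_clsCard_add_le` over the pencil bounds the arc by `100 + w - 20 * ⌈w / 4⌉`, which is at most 68
once `w ≥ 5`. -/
theorem clsCard_le_four (ho : ProjectivePlane.order P L = 4) (H : SegmentedArc cls seg val)
    (hι : 69 ≤ Fintype.card ι) (c : P) : clsCard cls c ≤ 4 := by
  by_contra! hc
  have h1 := sum_pencil (L := L) c (clsCard cls)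
  rw [ho, sum_clsCard] at h1
  have h2 : ∀ l ∈ lns L c, ∑ c' ∈ pts P l, clsCard cls c' ≤
      20 + clsCard cls c - 4 * ((clsCard cls c + 3) / 4) := by
    intro l hl
    obtain ⟨u, hu⟩ : ∃ u, clsCard cls c ≤ 4 * segCard cls seg c l u := by
      by_contra! hcon
      have h3 := sum_segCard cls seg c l
      rw [Fin.sum_univ_four] at h3
      have := hcon 0
      have := hcon 1
      have := hcon 2
      have := hcon 3
      omega
    have := H.sum_clsCard_add_le ho (mem_lns.1 hl) u
    omega
  have h3 := sum_le_card_nsmul _ _ _ h2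
  rw [h1, card_lns_eq ho, smul_eq_mul] at h3
  omega

theorem deficiencySystem (ho : ProjectivePlane.order P L = 4) (H : SegmentedArc cls seg val)
    (hι : 69 ≤ Fintype.card ι) :
    DeficiencySystem (fun c => 4 - clsCard cls c) (doubleCount cls seg) := by
  have hw := H.clsCard_le_four ho hι
  set d : P → ℕ := fun c => 4 - clsCard cls c with hd
  have hdw : ∀ c, d c + clsCard cls c = 4 := fun c => by
    have := hw c
    simp only [hd]
    omega
  have htot : ∑ c, d c + Fintype.card ι = 84 := by
    rw [← sum_clsCard cls, ← sum_add_distrib, sum_congr rfl fun c _ => hdw c, sum_const,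
      card_univ, card_points_eq ho]
    rfl
  have hline : ∀ l : L, lineSum d l + ∑ c ∈ pts P l, clsCard cls c = 20 := by
    intro l
    rw [lineSum, ← sum_add_distrib, sum_congr rfl fun c _ => hdw c, sum_const, card_pts_eq ho]
    rfl
  have hseg : ∀ (c : P) (l : L), c ∈ l → ∀ u, 4 * segCard cls seg c l u + d c ≤
      4 + lineSum d l := by
    intro c l hc u
    have h1 := H.sum_clsCard_add_le ho hc u
    have h2 := hline l
    have h3 := hdw c
    omega
  set pr : P → L → ℕ := fun c l => ∑ u, segCard cls seg c l u * (segCard cls seg c l u - 1)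
    with hpr
  have hpairs : ∀ c, ∑ l ∈ lns L c, pr c l = clsCard cls c * (clsCard cls c - 1) := H.sum_pairs
  refine ⟨by omega, fun c => Nat.sub_le _ _, ?_, ?_, ?_⟩
  · intro c hc
    rw [or_iff_not_imp_right]
    intro hno
    push Not at hno
    have hc4 := hdw c
    rcases Nat.le_one_iff_eq_zero_or_eq_one.1 hc with hc0 | hc1
    -- With four points in the class, a segment of size 2 or 3 needs deficiency 4 or 8; size 4 would
    -- need 12, which `hno` excludes.
    · have hcl : ∀ l, c ∈ l → pr c l = 0 ∨ 4 ≤ lineSum d l ∧ (pr c l = 2 ∨ pr c l = 4 ∧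
          doubleCount cls seg c l = 2) ∨ 8 ≤ lineSum d l ∧ pr c l = 6 := by
        intro l hl
        have hs := hseg c l hl
        have hn := hno l hl
        have hsum := sum_segCard cls seg c l
        simp only [hpr, doubleCount]
        rw [Fin.sum_univ_four] at hsum ⊢
        rw [Fin.sum_univ_four]
        have s0 := hs 0
        have s1 := hs 1
        have s2 := hs 2
        have s3 := hs 3
        have := four_on_segments ⟨segCard cls seg c l 0, by omega⟩
          ⟨segCard cls seg c l 1, by omega⟩ ⟨segCard cls seg c l 2, by omega⟩
          ⟨segCard cls seg c l 3, by omega⟩ (by simp only; omega)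
        simp only at this
        rcases this with h | ⟨h, h'⟩ | ⟨h, h'⟩
        · exact Or.inl h
        · exact Or.inr (Or.inl ⟨by omega, h'⟩)
        · exact Or.inr (Or.inr ⟨by omega, h'⟩)
      have hp := hpairs c
      rw [show clsCard cls c = 4 by omega] at hp
      have hpen := sum_lineSum (d := d) ho c
      have hpen' : 4 * ∑ l ∈ lns L c, (if pr c l = 0 then 0 else if pr c l = 6 then 2 else 1) ≤
          ∑ l ∈ lns L c, lineSum d l := by
        rw [mul_sum]
        refine sum_le_sum fun l hl => ?_
        have := hcl l (mem_lns.1 hl)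
        split_ifs <;> omega
      -- The pencil sum is at most 15, so at most three units of 4 are available, and 12 ordered
      -- pairs are needed. A unit yields at most 4 pairs, only from two double segments; directions
      -- with 2 or 6 pairs waste 2, so they cannot occur.
      have hbad : 4 * ∑ l ∈ lns L c, (if pr c l = 0 then 0 else if pr c l = 6 then 2 else 1) =
          ∑ l ∈ lns L c, pr c l +
            2 * ∑ l ∈ lns L c, (if pr c l = 0 ∨ pr c l = 4 then 0 else 1) := by
        rw [mul_sum, mul_sum, ← sum_add_distrib]
        refine sum_congr rfl fun l hl => ?_
        have := hcl l (mem_lns.1 hl)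
        split_ifs <;> omega
      have h0 : ∑ l ∈ lns L c, (if pr c l = 0 ∨ pr c l = 4 then 0 else 1) = 0 := by omega
      have h04 : ∀ l ∈ lns L c, pr c l = 0 ∨ pr c l = 4 := by
        intro l hl
        by_contra hcon
        have := sum_eq_zero_iff.1 h0 l hl
        rw [if_neg hcon] at this
        omega
      refine ⟨(lns L c).filter fun l => pr c l = 4, ?_, ?_⟩
      · have : 4 * ((lns L c).filter fun l => pr c l = 4).card = ∑ l ∈ lns L c, pr c l := by
          rw [card_filter, mul_sum]
          refine sum_congr rfl fun l hl => ?_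
          rcases h04 l hl with h | h <;> simp [h]
        omega
      · intro l hl
        obtain ⟨h1, h2⟩ := mem_filter.1 hl
        have := hcl l (mem_lns.1 h1)
        exact ⟨mem_lns.1 h1, by omega, by omega⟩
    -- Three points on one segment would need deficiency `8 + 1 = 9`, excluded by `hno`. So the 6
    -- ordered pairs are spread over three directions.
    · have hcl : ∀ l, c ∈ l → pr c l = 0 ∨ 5 ≤ lineSum d l ∧ pr c l = 2 ∧
          doubleCount cls seg c l = 1 := by
        intro l hl
        have hs := hseg c l hl
        have hn := hno l hl
        have hsum := sum_segCard cls seg c l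
        simp only [hpr, doubleCount]
        rw [Fin.sum_univ_four] at hsum ⊢
        rw [Fin.sum_univ_four]
        have s0 := hs 0
        have s1 := hs 1
        have s2 := hs 2
        have s3 := hs 3
        have := three_on_segments ⟨segCard cls seg c l 0, by omega⟩
          ⟨segCard cls seg c l 1, by omega⟩ ⟨segCard cls seg c l 2, by omega⟩
          ⟨segCard cls seg c l 3, by omega⟩ (by simp only; omega)
        simp only at this
        rcases this with h | ⟨h, h'⟩
        · exact Or.inl h
        · exact Or.inr ⟨by omega, h'⟩
      have hp := hpairs c
      rw [show clsCard cls c = 3 by omega] at hp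
      refine ⟨(lns L c).filter fun l => pr c l = 2, ?_, ?_⟩
      · have : 2 * ((lns L c).filter fun l => pr c l = 2).card = ∑ l ∈ lns L c, pr c l := by
          rw [card_filter, mul_sum]
          refine sum_congr rfl fun l hl => ?_
          rcases hcl l (mem_lns.1 hl) with h | h <;> simp [h]
        omega
      · intro l hl
        obtain ⟨h1, h2⟩ := mem_filter.1 hl
        have := hcl l (mem_lns.1 h1)
        exact ⟨mem_lns.1 h1, by omega, by omega⟩
  · intro c hc
    have hc4 := hdw c
    have hp := hpairs c
    rw [show clsCard cls c = 2 by omega] at hp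
    obtain ⟨l, hl, hl0⟩ := exists_ne_zero_of_sum_ne_zero
      (by rw [hp]; norm_num : ∑ l ∈ lns L c, pr c l ≠ 0)
    obtain ⟨u, -, hu⟩ := exists_ne_zero_of_sum_ne_zero hl0
    have hu2 : 2 ≤ segCard cls seg c l u := by
      by_contra! hcon
      apply hu
      interval_cases segCard cls seg c l u <;> rfl
    have hs := hseg c l (mem_lns.1 hl) u
    refine ⟨l, mem_lns.1 hl, by omega, ?_⟩
    have h1 : (if 2 ≤ segCard cls seg c l u then 1 else 0) ≤ doubleCount cls seg c l :=
      single_le_sum (f := fun u => if 2 ≤ segCard cls seg c l u then 1 else 0)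
        (fun _ _ => Nat.zero_le _) (mem_univ u)
    rwa [if_pos hu2] at h1
  · intro c l hc hb
    exact H.sum_doubleCount_le ho hc hb

theorem card_le_sixtyEight (ho : ProjectivePlane.order P L = 4)
    (H : SegmentedArc cls seg val) : Fintype.card ι ≤ 68 := by
  by_contra! hcon
  exact (H.deficiencySystem ho hcon).false ho

end SegmentedArc

end Segments
end Hjelmslev

namespace Hjelmslev

/-! ### Chain rings of length two: points, lines and rows. -/

section Residue

open Configuration Finset Matrix MulOpposite
open scoped LinearAlgebra.Projectivization

/-- `π` is the residue map of a chain ring of length two whose radical is generated, on both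
sides, by `θ`. -/
structure IsUniformizer {R k : Type*} [Ring R] [Field k] (π : R →+* k) (θ : R) : Prop where
  surjective : Function.Surjective π
  ne_zero : θ ≠ 0
  map_eq_zero : π θ = 0
  exists_right : ∀ x, π x = 0 → ∃ r, x = θ * r
  exists_left : ∀ x, π x = 0 → ∃ r, x = r * θ
  mul_left_eq_zero : ∀ r, θ * r = 0 ↔ π r = 0
  mul_right_eq_zero : ∀ r, r * θ = 0 ↔ π r = 0

/-- The submodule of the right module `R³` annihilated by a row. -/
def rowKer {R : Type*} [Ring R] (a : Fin 3 → R) : Submodule Rᵐᵒᵖ (Fin 3 → R) where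
  carrier := {v | a ⬝ᵥ v = 0}
  add_mem' {v w} hv hw := by
    simp only [Set.mem_ofPred_eq] at hv hw ⊢
    rw [dotProduct_add, hv, hw, add_zero]
  zero_mem' := by simp
  smul_mem' r v hv := by
    simp only [Set.mem_ofPred_eq] at hv ⊢
    rw [dotProduct_smul, hv, smul_zero]

theorem mem_rowKer {R : Type*} [Ring R] {a v : Fin 3 → R} : v ∈ rowKer a ↔ a ⬝ᵥ v = 0 := Iff.rfl

theorem sum_fin_three {M : Type*} [AddCommMonoid M] (f : Fin 3 → M) {i j l : Fin 3}
    (hij : i ≠ j) (hil : i ≠ l) (hjl : j ≠ l) : ∑ m, f m = f i + f j + f l := by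
  have h : (univ : Finset (Fin 3)) = {i, j, l} := by
    revert i j l
    decide
  rw [h, sum_insert (by simp [hij, hil]), sum_insert (by simp [hjl]), sum_singleton, add_assoc]

namespace IsUniformizer

variable {R k : Type*} [Ring R] [Field k] {π : R →+* k} {θ : R}

/-- The kernel of `π` has square zero, so an `x` with residue 1 has inverse `2 - x`; a lift of the
inverse residue reduces the general case to this one. -/
theorem exists_inv (h : IsUniformizer π θ) {r : R} (hr : π r ≠ 0) :
    ∃ s, r * s = 1 ∧ s * r = 1 := by
  obtain ⟨s, hs⟩ := h.surjective (π r)⁻¹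
  have key : ∀ x, π x = 1 → ∃ y, x * y = 1 ∧ y * x = 1 := by
    intro x hx
    have hn : π (x - 1) = 0 := by rw [map_sub, hx, map_one, sub_self]
    obtain ⟨a, ha⟩ := h.exists_right _ hn
    have hsq : (x - 1) * (x - 1) = 0 := by
      conv_lhs => rw [ha]
      rw [mul_assoc, h.mul_left_eq_zero, ← ha, map_mul, hn, mul_zero]
    refine ⟨2 - x, ?_, ?_⟩
    · calc x * (2 - x) = 1 - (x - 1) * (x - 1) := by noncomm_ring
        _ = 1 := by rw [hsq, sub_zero]
    · calc (2 - x) * x = 1 - (x - 1) * (x - 1) := by noncomm_ring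
        _ = 1 := by rw [hsq, sub_zero]
  obtain ⟨y, hy, -⟩ := key (r * s) (by rw [map_mul, hs, mul_inv_cancel₀ hr])
  obtain ⟨z, -, hz⟩ := key (s * r) (by rw [map_mul, hs, inv_mul_cancel₀ hr])
  have h1 : r * (s * y) = 1 := by rw [← mul_assoc, hy]
  have h2 : (z * s) * r = 1 := by rw [mul_assoc, hz]
  have h3 : s * y = z * s := by
    calc s * y = (z * s * r) * (s * y) := by rw [h2, one_mul]
      _ = z * s * (r * (s * y)) := by noncomm_ring
      _ = z * s := by rw [h1, mul_one]
  exact ⟨s * y, h1, h3 ▸ h2⟩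

/-- The unit entry lets the coordinate `i` be solved for, making the annihilator a graph over the
other two. -/
theorem isFreeOfRank_rowKer (h : IsUniformizer π θ) {a : Fin 3 → R} {i : Fin 3}
    (hi : π (a i) ≠ 0) : IsFreeOfRank 2 (rowKer a) := by
  obtain ⟨s, hs1, hs2⟩ := h.exists_inv hi
  refine ⟨Module.Basis.ofEquivFun
    { toFun := fun v j => op (v.1 (i.succAbove j))
      map_add' := fun v w => rfl
      map_smul' := fun r v => by
        ext j
        simp
      invFun := fun w => ⟨i.insertNth (-(s * ∑ j, a (i.succAbove j) * unop (w j)))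
        (fun j => unop (w j)), ?_⟩
      left_inv := ?_
      right_inv := ?_ }⟩
  · rw [mem_rowKer, dotProduct, Fin.sum_univ_succAbove _ i]
    simp only [Fin.insertNth_apply_same, Fin.insertNth_apply_succAbove]
    rw [mul_neg, ← mul_assoc, hs1, one_mul, neg_add_cancel]
  · rintro ⟨v, hv⟩
    rw [mem_rowKer, dotProduct, Fin.sum_univ_succAbove _ i] at hv
    ext j
    refine Fin.succAboveCases i ?_ (fun j => ?_) j
    · simp only [Fin.insertNth_apply_same, unop_op]
      rw [← eq_neg_iff_add_eq_zero] at hv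
      rw [← mul_neg, ← hv, ← mul_assoc, hs2, one_mul]
    · simp only [Fin.insertNth_apply_succAbove, unop_op]
  · intro w
    ext j
    simp

theorem isFreeOfRank_span (h : IsUniformizer π θ) {v : Fin 3 → R} {i : Fin 3}
    (hi : π (v i) ≠ 0) : IsFreeOfRank 1 (Submodule.span Rᵐᵒᵖ {v}) := by
  obtain ⟨s, hs1, -⟩ := h.exists_inv hi
  have hli : LinearIndependent Rᵐᵒᵖ (fun _ : Fin 1 => v) := by
    rw [Fintype.linearIndependent_iff]
    intro g hg j
    rw [Fin.sum_univ_one] at hg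
    have h1 := congrFun hg i
    simp only [Pi.smul_apply, smul_eq_mul_unop, Pi.zero_apply] at h1
    obtain ⟨s', -, hs2⟩ := h.exists_inv hi
    have h2 : unop (g 0) = 0 := by
      rw [← one_mul (unop (g 0)), ← hs2, mul_assoc, h1, mul_zero]
    rw [Subsingleton.elim j 0]
    exact unop_injective h2
  have := Module.Basis.span hli
  rw [Set.range_const] at this
  exact ⟨this⟩

/-- A basis vector with all coordinates in the radical would be killed by `θ`. -/
theorem exists_span_eq (h : IsUniformizer π θ) (x : Point R) :
    ∃ v : Fin 3 → R, (∃ i, π (v i) ≠ 0) ∧ x.1 = Submodule.span Rᵐᵒᵖ {v} := by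
  obtain ⟨M, ⟨b⟩⟩ := x
  refine ⟨(b 0 : Fin 3 → R), ?_, ?_⟩
  · by_contra! hcon
    have h1 : op θ • b 0 = 0 := by
      ext i
      simp [h.mul_right_eq_zero, hcon]
    have h2 := congrArg (fun y => b.repr y 0) h1
    simp only [map_smul, Module.Basis.repr_self, Finsupp.smul_apply, Finsupp.single_eq_same,
      map_zero, Finsupp.coe_zero, Pi.zero_apply, smul_eq_mul, mul_one] at h2
    exact h.ne_zero (op_injective h2)
  · have h1 := b.span_eq
    have h2 := congrArg (Submodule.map M.subtype) h1
    rw [Submodule.map_span, Submodule.map_subtype_top, Set.range_unique, Set.image_singleton] at h2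
    exact h2.symm

/-- Every line is contained in the annihilator of a unimodular row. -/
theorem exists_row (h : IsUniformizer π θ) (N : Line R) :
    ∃ a : Fin 3 → R, (∃ i, π (a i) ≠ 0) ∧ N.1 ≤ rowKer a := by
  obtain ⟨M, ⟨b⟩⟩ := N
  set u : Fin 3 → R := (b 0 : Fin 3 → R) with hu
  set v : Fin 3 → R := (b 1 : Fin 3 → R) with hv
  have hli : ∀ r s : R, (∀ m, u m * r + v m * s = 0) → r = 0 ∧ s = 0 := by
    intro r s hrs
    have hb := b.linearIndependent
    rw [Fintype.linearIndependent_iff] at hb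
    have h1 := hb ![op r, op s] (by
      rw [Fin.sum_univ_two]
      ext m
      simpa using hrs m)
    exact ⟨op_injective (h1 0), op_injective (h1 1)⟩
  obtain ⟨i, hi⟩ : ∃ i, π (u i) ≠ 0 := by
    by_contra! hcon
    refine h.ne_zero (hli θ 0 fun m => ?_).1
    rw [mul_zero, add_zero, h.mul_right_eq_zero]
    exact hcon m
  obtain ⟨q, hq1, hq2⟩ := h.exists_inv hi
  -- Gaussian elimination: `v'` vanishes at `i` and still has a unit coordinate, otherwise `v' * θ =
  -- 0` would be a relation between `u` and `v`. The row is then solved for with entry 1 at `l`.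
  set v' : Fin 3 → R := fun m => v m - u m * q * v i with hv'
  obtain ⟨j, hj⟩ : ∃ j, π (v' j) ≠ 0 := by
    by_contra! hcon
    refine h.ne_zero (hli (-(q * v i * θ)) θ fun m => ?_).2
    have := (h.mul_right_eq_zero _).2 (hcon m)
    rw [← this]
    simp only [hv']
    noncomm_ring
  have hij : i ≠ j := by
    rintro rfl
    apply hj
    simp only [hv']
    rw [hq1, one_mul, sub_self, map_zero]
  obtain ⟨p, hp1, hp2⟩ := h.exists_inv hj
  obtain ⟨l, hil, hjl⟩ : ∃ l, i ≠ l ∧ j ≠ l :=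
    (by decide : ∀ i j : Fin 3, ∃ l, i ≠ l ∧ j ≠ l) i j
  set a : Fin 3 → R := fun m => if m = i then -(u l * q) + v' l * p * u j * q else
    if m = j then -(v' l * p) else 1 with ha
  have hsum : ∀ f : Fin 3 → R, a ⬝ᵥ f =
      (-(u l * q) + v' l * p * u j * q) * f i + -(v' l * p) * f j + f l := by
    intro f
    rw [dotProduct, sum_fin_three _ hij hil hjl]
    simp [ha, hij.symm, hil.symm, hjl.symm]
  refine ⟨a, ⟨l, ?_⟩, ?_⟩
  · simp [ha, hil.symm, hjl.symm]
  · have hau : u ∈ rowKer a := by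
      rw [mem_rowKer, hsum]
      calc _ = -(u l * (q * u i)) + v' l * p * u j * (q * u i) + -(v' l * p) * u j + u l := by
            noncomm_ring
        _ = 0 := by
          rw [hq2]
          noncomm_ring
    have hav : v ∈ rowKer a := by
      rw [mem_rowKer, hsum]
      calc _ = (v l - u l * q * v i) - v' l * (p * (v j - u j * q * v i)) := by
            noncomm_ring
        _ = v' l - v' l * (p * v' j) := rfl
        _ = 0 := by rw [hp2, mul_one, sub_self]
    intro w hw
    have h1 := b.sum_repr ⟨w, hw⟩
    rw [Fin.sum_univ_two] at h1
    have h2 := congrArg Subtype.val h1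
    simp only [Submodule.coe_add, Submodule.coe_smul] at h2
    rw [← h2]
    exact Submodule.add_mem _ (Submodule.smul_mem _ _ hau) (Submodule.smul_mem _ _ hav)

end IsUniformizer

end Residue
end Hjelmslev

namespace Hjelmslev

/-! ### The upper bound for chain rings with residue field of order 4. -/

section Residue

open Configuration Finset Matrix MulOpposite
open scoped LinearAlgebra.Projectivization

theorem mem_iff_rep_dotProduct {k : Type*} [Field k] (c l : ℙ k (Fin 3 → k)) :
    c ∈ l ↔ l.rep ⬝ᵥ c.rep = 0 := by
  conv_lhs => rw [← c.mk_rep, ← l.mk_rep]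
  rw [dotProduct_comm]
  exact Projectivization.orthogonal_mk c.rep_nonzero l.rep_nonzero

variable {k : Type*} [Field k] [DecidableEq k]

theorem order_eq_four (hk : Nat.card k = 4) :
    ProjectivePlane.order (ℙ k (Fin 3 → k)) (ℙ k (Fin 3 → k)) = 4 := by
  have : Finite k := Nat.finite_of_card_ne_zero (by omega)
  have : Fintype (ℙ k (Fin 3 → k)) := Fintype.ofFinite _
  have h1 := ProjectivePlane.card_points (ℙ k (Fin 3 → k)) (ℙ k (Fin 3 → k))
  have h2 := Projectivization.card_of_finrank k (Fin 3 → k) (n := 3) (by simp)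
  rw [Nat.card_eq_fintype_card, h1, hk] at h2
  norm_num [Finset.sum_range_succ] at h2
  nlinarith

/-- Distinct points give independent functionals, so the 64 vectors are equidistributed over the 16
pairs of values. -/
theorem card_dotProduct_fiber [Fintype k] (hk : Nat.card k = 4) {c c' : ℙ k (Fin 3 → k)}
    (h : c ≠ c') (u v : k) :
    (univ.filter fun t : Fin 3 → k => t ⬝ᵥ c.rep = u ∧ t ⬝ᵥ c'.rep = v).card = 4 := by
  have : Fintype (ℙ k (Fin 3 → k)) := Fintype.ofFinite _
  have key : ∀ c c' : ℙ k (Fin 3 → k), c ≠ c' →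
      ∃ t : Fin 3 → k, t ⬝ᵥ c.rep = 0 ∧ t ⬝ᵥ c'.rep = 1 := by
    intro c c' h
    obtain ⟨l, hl, hl'⟩ : ∃ l ∈ lns (ℙ k (Fin 3 → k)) c, c' ∉ l := by
      by_contra! hcon
      classical
      have h1 := card_lns_inter (L := ℙ k (Fin 3 → k)) h
      have h2 := card_lns_eq (L := ℙ k (Fin 3 → k)) (order_eq_four hk) c
      rw [Finset.filter_true_of_mem hcon, h2] at h1
      omega
    rw [mem_lns, mem_iff_rep_dotProduct] at hl
    rw [mem_iff_rep_dotProduct] at hl'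
    refine ⟨(l.rep ⬝ᵥ c'.rep)⁻¹ • l.rep, ?_, ?_⟩
    · rw [smul_dotProduct, hl, smul_zero]
    · rw [smul_dotProduct, smul_eq_mul, inv_mul_cancel₀ hl']
  obtain ⟨t, ht, ht'⟩ := key c c' h
  obtain ⟨s, hs', hs⟩ := key c' c h.symm
  let f : (Fin 3 → k) →+ k × k :=
    { toFun := fun t => (t ⬝ᵥ c.rep, t ⬝ᵥ c'.rep)
      map_zero' := by simp
      map_add' := fun x y => by simp [add_dotProduct] }
  have hf : Function.Surjective f := by
    rintro ⟨x, y⟩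
    refine ⟨x • s + y • t, ?_⟩
    simp [f, add_dotProduct, smul_dotProduct, hs, hs', ht, ht']
  have h1 : ∀ x : k × k, (univ.filter fun t => f t = x).card =
      (univ.filter fun t => f t = (u, v)).card := fun x =>
    AddMonoidHom.card_fiber_eq_of_mem_range f (hf x) (hf (u, v))
  have h2 : (univ : Finset (Fin 3 → k)).card = ∑ x : k × k, (univ.filter fun t => f t = x).card :=
    card_eq_sum_card_fiberwise fun _ _ => mem_coe.2 (mem_univ _)
  rw [sum_congr rfl fun x _ => h1 x, sum_const, card_univ, card_univ, Fintype.card_fun,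
    Fintype.card_prod, ← Nat.card_eq_fintype_card, hk, Fintype.card_fin, smul_eq_mul] at h2
  have h3 : (univ.filter fun t : Fin 3 → k => t ⬝ᵥ c.rep = u ∧ t ⬝ᵥ c'.rep = v) =
      univ.filter fun t => f t = (u, v) := by
    ext t
    simp [f]
  rw [h3]
  omega

namespace IsUniformizer

variable {R : Type*} [Ring R] {π : R →+* k} {θ : R}

omit [DecidableEq k] in
theorem exists_class (h : IsUniformizer π θ) (x : Point R) :
    ∃ (c : ℙ k (Fin 3 → k)) (v : Fin 3 → R), (∀ i, π (v i) = c.rep i) ∧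
      x.1 = Submodule.span Rᵐᵒᵖ {v} := by
  obtain ⟨v, ⟨i, hi⟩, hx⟩ := h.exists_span_eq x
  have hv : (fun i => π (v i)) ≠ 0 := fun h0 => hi (congrFun h0 i)
  obtain ⟨a, ha⟩ := Projectivization.exists_smul_eq_mk_rep k _ hv
  obtain ⟨r, hr⟩ := h.surjective a
  obtain ⟨s, hrs, hsr⟩ := h.exists_inv (r := r) (by rw [hr]; exact a.ne_zero)
  refine ⟨Projectivization.mk k _ hv, fun i => v i * r, fun i => ?_, ?_⟩
  · rw [← ha, map_mul, hr, mul_comm]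
    rfl
  · rw [hx]
    refine le_antisymm ?_ ?_
    · rw [Submodule.span_singleton_le_iff_mem, Submodule.mem_span_singleton]
      refine ⟨op s, ?_⟩
      ext i
      simp [mul_assoc, hrs]
    · rw [Submodule.span_singleton_le_iff_mem, Submodule.mem_span_singleton]
      exact ⟨op r, rfl⟩

-- If `v - w = e * θ` and `e` is proportional to `w` modulo the radical, then `v = w * (1 + r * θ)`.
-- So neighbouring points that differ have a difference pointing to another class.
omit [DecidableEq k] in
theorem span_le_of_sub_eq (h : IsUniformizer π θ) {v w e : Fin 3 → R} {a : k}
    (he : ∀ i, v i - w i = e i * θ) (ha : ∀ i, π (e i) = a * π (w i)) :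
    Submodule.span Rᵐᵒᵖ {v} ≤ Submodule.span Rᵐᵒᵖ {w} := by
  obtain ⟨r, hr⟩ := h.surjective a
  rw [Submodule.span_singleton_le_iff_mem, Submodule.mem_span_singleton]
  refine ⟨op (1 + r * θ), ?_⟩
  ext i
  have h1 : (e i - w i * r) * θ = 0 := by
    rw [h.mul_right_eq_zero, map_sub, map_mul, ha, hr, mul_comm, sub_self]
  simp only [Pi.smul_apply, smul_eq_mul_unop, unop_op]
  rw [eq_comm, ← sub_eq_zero]
  calc v i - w i * (1 + r * θ) = (v i - w i) - w i * r * θ := by noncomm_ring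
    _ = (e i - w i * r) * θ := by rw [he, sub_mul]
    _ = 0 := h1

/-- The upper bound for arcs in the plane over a chain ring of length two and order `16`. -/
theorem card_le_sixtyEight (h : IsUniformizer π θ) (hk : Nat.card k = 4)
    (K : Finset (Point R)) (hK : ∀ L : Line R, lineMultiplicity K L ≤ 5) : K.card ≤ 68 := by
  classical
  have : Finite k := Nat.finite_of_card_ne_zero (by omega)
  have : Fintype k := Fintype.ofFinite _
  have : Fintype (ℙ k (Fin 3 → k)) := Fintype.ofFinite _
  choose cls v hv hspan using fun x : K => h.exists_class x.1
  choose σ hσ using h.surjective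
  let ro : ℙ k (Fin 3 → k) → (Fin 3 → R) := fun l i => σ (l.rep i)
  have hπ : ∀ a w : Fin 3 → R, π (a ⬝ᵥ w) = (fun i => π (a i)) ⬝ᵥ (fun i => π (w i)) := by
    intro a w
    simp [dotProduct]
  have hπro : ∀ l x, π (ro l ⬝ᵥ v x) = l.rep ⬝ᵥ (cls x).rep := by
    intro l x
    rw [hπ]
    simp only [ro, hσ, hv]
  have hex : ∀ l x, ∃ r, cls x ∈ l → ro l ⬝ᵥ v x = θ * r := by
    intro l x
    by_cases hx : cls x ∈ l
    · obtain ⟨r, hr⟩ := h.exists_right (ro l ⬝ᵥ v x)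
        (by rw [hπro, ← mem_iff_rep_dotProduct]; exact hx)
      exact ⟨r, fun _ => hr⟩
    · exact ⟨0, fun h => absurd h hx⟩
  -- Since `θ * r = 0` exactly when `π r = 0`, the residue of `s l x` is determined; it names the
  -- segment of `x` in direction `l`.
  choose s hs using hex
  have e : k ≃ Fin 4 := Fintype.equivFinOfCardEq (by rw [← Nat.card_eq_fintype_card, hk])
  have hle : ∀ (x : K) (a : Fin 3 → R), x.1.1 ≤ rowKer a ↔ a ⬝ᵥ v x = 0 := by
    intro x a
    rw [hspan, Submodule.span_singleton_le_iff_mem, mem_rowKer]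
  have H : SegmentedArc cls (fun l x => e (π (s l x)))
      (fun (t : Fin 3 → k) c => e (-(t ⬝ᵥ c.rep))) := by
    refine ⟨?_, ?_, ?_⟩
    · intro c c' hc x y
      refine (congrArg card ?_).trans (card_dotProduct_fiber hk hc (-(e.symm x)) (-(e.symm y)))
      ext t
      simp only [mem_filter, mem_univ, true_and]
      rw [← e.eq_symm_apply, ← e.eq_symm_apply, neg_eq_iff_eq_neg, neg_eq_iff_eq_neg]
    · intro x y hxy hcls
      choose δ hδ using fun i => h.exists_left (v x i - v y i)
        (by rw [map_sub, hv, hv, hcls, sub_self])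
      -- Two neighbours share a segment in direction `l` exactly when `l` passes through the class
      -- of the residue of `δ`. The common direction is thus the line joining that class to `cls x`.
      have hdiff : ∀ l, cls x ∈ l →
          (π (s l x) = π (s l y) ↔ l.rep ⬝ᵥ (fun i => π (δ i)) = 0) := by
        intro l hl
        have h1 : θ * (s l x - s l y) = (ro l ⬝ᵥ δ) * θ := by
          rw [mul_sub, ← hs l x hl, ← hs l y (hcls ▸ hl), ← dotProduct_sub]
          simp only [dotProduct, sum_mul, Pi.sub_apply, hδ, mul_assoc]
        rw [← sub_eq_zero, ← map_sub, ← h.mul_left_eq_zero, h1, h.mul_right_eq_zero, hπ]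
        simp only [ro, hσ]
      have hnot : ∀ a : k, ¬ ∀ i, π (δ i) = a * (cls y).rep i := by
        intro a ha
        apply hxy
        apply Subtype.ext
        apply Subtype.ext
        rw [hspan, hspan]
        refine le_antisymm (h.span_le_of_sub_eq hδ (a := a) fun i => ?_)
          (h.span_le_of_sub_eq (e := fun i => -δ i) (a := -a) (fun i => ?_) fun i => ?_)
        · rw [ha, hv]
        · rw [neg_mul, ← hδ, neg_sub]
        · rw [map_neg, ha, hv, hcls, neg_mul]
      have hδ0 : (fun i => π (δ i)) ≠ 0 := by
        intro h0
        refine hnot 0 fun i => ?_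
        rw [zero_mul]
        exact congrFun h0 i
      have hne : cls x ≠ Projectivization.mk k _ hδ0 := by
        intro heq
        obtain ⟨a, ha⟩ := Projectivization.exists_smul_eq_mk_rep k _ hδ0
        rw [← heq, hcls] at ha
        refine hnot (a⁻¹ : kˣ) fun i => ?_
        rw [← ha]
        simp [Units.smul_def]
      have hmem : ∀ l : ℙ k (Fin 3 → k), Projectivization.mk k _ hδ0 ∈ l ↔
          l.rep ⬝ᵥ (fun i => π (δ i)) = 0 := by
        intro l
        conv_lhs => rw [← l.mk_rep]
        rw [dotProduct_comm]
        exact Projectivization.orthogonal_mk hδ0 l.rep_nonzero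
      obtain ⟨l, hl, hu⟩ := HasLines.existsUnique_line (ℙ k (Fin 3 → k)) (ℙ k (Fin 3 → k)) _ _ hne
      refine ⟨l, hl.1, congrArg e ((hdiff l hl.1).2 ((hmem l).1 hl.2)), fun m hm hsm => ?_⟩
      exact hu m ⟨hm, (hmem m).2 ((hdiff m hm).1 (e.injective hsm))⟩
    · intro l t
      -- Perturbing the lifted row by `θ * σ (t i)` turns the incidence condition into `π (s l x) +
      -- t ⬝ᵥ (cls x).rep = 0`, whence the sign in `val`. Vectors `t` differing by a multiple of
      -- `l.rep` give the same line.
      let a : Fin 3 → R := fun i => σ (l.rep i) + θ * σ (t i)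
      have ha : ∀ i, π (a i) = l.rep i := fun i => by
        simp only [a, map_add, map_mul, h.map_eq_zero, zero_mul, add_zero, hσ]
      obtain ⟨i, hi⟩ : ∃ i, l.rep i ≠ 0 := by
        by_contra! hcon
        exact l.rep_nonzero (funext hcon)
      have hfree := h.isFreeOfRank_rowKer (a := a) (i := i) (by rw [ha]; exact hi)
      refine le_trans ?_ (hK ⟨rowKer a, hfree⟩)
      unfold lineMultiplicity
      refine card_le_card_of_injOn Subtype.val ?_ Subtype.val_injective.injOn
      intro x hx
      simp only [coe_filter, mem_univ, true_and, Set.mem_ofPred_eq] at hx ⊢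
      refine ⟨x.2, ?_⟩
      rw [hle]
      have h1 : a ⬝ᵥ v x = ro l ⬝ᵥ v x + θ * ((fun i => σ (t i)) ⬝ᵥ v x) := by
        simp only [a, ro, dotProduct, add_mul, sum_add_distrib, mul_sum, mul_assoc]
      rw [h1, hs l x hx.1, ← mul_add, h.mul_left_eq_zero, map_add, hπ]
      simp only [hσ, hv]
      rw [e.injective hx.2, neg_add_cancel]
  have := H.card_le_sixtyEight (order_eq_four hk)
  rwa [Fintype.card_coe] at this

end IsUniformizer

end Residue
end Hjelmslev

namespace Hjelmslev

/-! ### Verification of arcs by coded arithmetic. -/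

section Codes

open Finset Matrix MulOpposite

/-- `e` codes the elements of `R` by the numbers below `16`. The code of `1` is `4`, and `nu`
lists the codes of the nonunits. -/
structure RingCode {R k : Type*} [Ring R] [Field k] (π : R →+* k) (e : ℕ → R)
    (add mul : ℕ → ℕ → ℕ) (nu : List ℕ) : Prop where
  add_lt : ∀ x y, add x y < 16
  mul_lt : ∀ x y, mul x y < 16
  map_add : ∀ x < 16, ∀ y < 16, e (add x y) = e x + e y
  map_mul : ∀ x < 16, ∀ y < 16, e (mul x y) = e x * e y
  map_zero : e 0 = 0
  map_four : e 4 = 1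
  eq_zero : ∀ x < 16, e x = 0 → x = 0
  injective : ∀ x < 16, ∀ y < 16, e x = e y → x = y
  surjective : ∀ r, ∃ x < 16, e x = r
  mem_nu : ∀ x < 16, π (e x) = 0 ↔ x ∈ nu

/-- The dot product of coded vectors. -/
def codeDot (add mul : ℕ → ℕ → ℕ) (a v : ℕ × ℕ × ℕ) : ℕ :=
  add (add (mul a.1 v.1) (mul a.2.1 v.2.1)) (mul a.2.2 v.2.2)

/-- The row `a` annihilates at most five vectors of the list. -/
def rowGood (add mul : ℕ → ℕ → ℕ) (arc : List (ℕ × ℕ × ℕ)) (a : ℕ × ℕ × ℕ) : Bool :=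
  Nat.ble (arc.countP fun v => Nat.beq (codeDot add mul a v) 0) 5

/-- Every normalized row annihilates at most five vectors of the list. -/
def rowsGood (add mul : ℕ → ℕ → ℕ) (nu : List ℕ) (arc : List (ℕ × ℕ × ℕ)) : Bool :=
  (List.range 16).all (fun z =>
    (List.range 16).all (fun y => rowGood add mul arc (4, y, z)) &&
    nu.all (fun x => rowGood add mul arc (x, 4, z))) &&
  nu.all (fun y => nu.all fun x => rowGood add mul arc (x, y, 4))

/-- The first unit among the coordinates of the coded vector `v` is `1`. -/
def IsNormal (nu : List ℕ) (v : ℕ × ℕ × ℕ) : Prop :=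
  v.1 < 16 ∧ v.2.1 < 16 ∧ v.2.2 < 16 ∧
    (v.1 = 4 ∨ v.1 ∈ nu ∧ v.2.1 = 4 ∨ v.1 ∈ nu ∧ v.2.1 ∈ nu ∧ v.2.2 = 4)

instance (nu : List ℕ) (v : ℕ × ℕ × ℕ) : Decidable (IsNormal nu v) := by
  unfold IsNormal
  infer_instance

/-- The vector with code `v`. -/
def decodeVec {R : Type*} (e : ℕ → R) (v : ℕ × ℕ × ℕ) : Fin 3 → R :=
  ![e v.1, e v.2.1, e v.2.2]

namespace RingCode

variable {R k : Type*} [Ring R] [Field k] {π : R →+* k} {θ : R} {e : ℕ → R}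
  {add mul : ℕ → ℕ → ℕ} {nu : List ℕ}

theorem map_codeDot (E : RingCode π e add mul nu) {a v : ℕ × ℕ × ℕ}
    (ha : a.1 < 16 ∧ a.2.1 < 16 ∧ a.2.2 < 16) (hv : v.1 < 16 ∧ v.2.1 < 16 ∧ v.2.2 < 16) :
    e (codeDot add mul a v) = decodeVec e a ⬝ᵥ decodeVec e v := by
  rw [dotProduct, Fin.sum_univ_three, codeDot, E.map_add _ (E.add_lt _ _) _ (E.mul_lt _ _),
    E.map_add _ (E.mul_lt _ _) _ (E.mul_lt _ _), E.map_mul _ ha.1 _ hv.1,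
    E.map_mul _ ha.2.1 _ hv.2.1, E.map_mul _ ha.2.2 _ hv.2.2]
  rfl

theorem exists_ne_zero (E : RingCode π e add mul nu) {v : ℕ × ℕ × ℕ} (hv : IsNormal nu v) :
    ∃ i, π (decodeVec e v i) ≠ 0 := by
  rcases hv.2.2.2 with h | ⟨-, h⟩ | ⟨-, -, h⟩
  · exact ⟨0, by simp [decodeVec, h, E.map_four]⟩
  · exact ⟨1, by simp [decodeVec, h, E.map_four]⟩
  · exact ⟨2, by simp [decodeVec, h, E.map_four]⟩

/-- Generators of the same point are right multiples of each other, so their first unit coordinates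
are at the same place. Both being 1 there, the multiplier is 1. -/
theorem eq_of_span_eq (E : RingCode π e add mul nu) {v w : ℕ × ℕ × ℕ} (hv : IsNormal nu v)
    (hw : IsNormal nu w)
    (h : Submodule.span Rᵐᵒᵖ {decodeVec e v} = Submodule.span Rᵐᵒᵖ {decodeVec e w}) :
    v = w := by
  obtain ⟨r, hr⟩ := Submodule.mem_span_singleton.1
    (h ▸ Submodule.mem_span_singleton_self (decodeVec e v))
  obtain ⟨s, hs⟩ := Submodule.mem_span_singleton.1
    (h.symm ▸ Submodule.mem_span_singleton_self (decodeVec e w))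
  have hr' : ∀ i, decodeVec e w i * unop r = decodeVec e v i := fun i => congrFun hr i
  have hs' : ∀ i, decodeVec e v i * unop s = decodeVec e w i := fun i => congrFun hs i
  obtain ⟨hv1, hv2, hv3, hv⟩ := hv
  obtain ⟨hw1, hw2, hw3, hw⟩ := hw
  have key : ∀ (x y : Fin 3 → R) (t : R) (i : Fin 3), (∀ i, x i * t = y i) → y i = 1 →
      π (x i) ≠ 0 := by
    intro x y t i hxy hi h0
    have h1 := congrArg π (hxy i)
    rw [_root_.map_mul, h0, zero_mul, hi, map_one] at h1
    exact zero_ne_one h1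
  have hfin : ∀ i, decodeVec e v i = 1 → decodeVec e w i = 1 → v = w := by
    intro i h1 h2
    have h3 : unop r = 1 := by rw [← h1, ← hr' i, h2, one_mul]
    have h4 : ∀ j, decodeVec e w j = decodeVec e v j := fun j => by
      rw [← hr' j, h3, mul_one]
    refine Prod.ext ?_ (Prod.ext ?_ ?_)
    · exact (E.injective _ hw1 _ hv1 (h4 0)).symm
    · exact (E.injective _ hw2 _ hv2 (h4 1)).symm
    · exact (E.injective _ hw3 _ hv3 (h4 2)).symm
  have one : ∀ {x : ℕ}, x = 4 → e x = 1 := fun h => h ▸ E.map_four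
  rcases hv with hv | ⟨hv, hv'⟩ | ⟨hv, hv', hv''⟩ <;>
    rcases hw with hw | ⟨hw, hw'⟩ | ⟨hw, hw', hw''⟩
  · exact hfin 0 (one hv) (one hw)
  · exact absurd ((E.mem_nu _ hw1).2 hw) (key _ _ _ 0 hr' (one hv))
  · exact absurd ((E.mem_nu _ hw1).2 hw) (key _ _ _ 0 hr' (one hv))
  · exact absurd ((E.mem_nu _ hv1).2 hv) (key _ _ _ 0 hs' (one hw))
  · exact hfin 1 (one hv') (one hw')
  · exact absurd ((E.mem_nu _ hw2).2 hw') (key _ _ _ 1 hr' (one hv'))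
  · exact absurd ((E.mem_nu _ hv1).2 hv) (key _ _ _ 0 hs' (one hw))
  · exact absurd ((E.mem_nu _ hv2).2 hv') (key _ _ _ 1 hs' (one hw'))
  · exact hfin 2 (one hv'') (one hw'')

/-- Every unimodular row has the same annihilator as a normalized row. -/
theorem exists_normal_row (E : RingCode π e add mul nu) (h : IsUniformizer π θ)
    {a : Fin 3 → R} (ha : ∃ i, π (a i) ≠ 0) :
    ∃ c : ℕ × ℕ × ℕ, IsNormal nu c ∧ rowKer a ≤ rowKer (decodeVec e c) := by
  have key : ∀ i, π (a i) ≠ 0 → ∃ c : ℕ × ℕ × ℕ, (c.1 < 16 ∧ c.2.1 < 16 ∧ c.2.2 < 16) ∧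
      decodeVec e c i = 1 ∧ (∀ j, π (a j) = 0 → π (decodeVec e c j) = 0) ∧
      rowKer a ≤ rowKer (decodeVec e c) := by
    intro i hi
    obtain ⟨s, -, hs⟩ := h.exists_inv hi
    choose f hf hf' using fun j => E.surjective (s * a j)
    have hd : decodeVec e (f 0, f 1, f 2) = fun j => s * a j := by
      ext j
      fin_cases j <;> simp [decodeVec, hf']
    refine ⟨(f 0, f 1, f 2), ⟨hf 0, hf 1, hf 2⟩, by rw [hd]; exact hs, fun j hj => ?_,
      fun v hv => ?_⟩
    · rw [hd]
      simp [hj]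
    · rw [mem_rowKer] at hv ⊢
      rw [hd]
      have : (fun j => s * a j) = s • a := rfl
      rw [this, smul_dotProduct, hv, smul_zero]
  have four : ∀ {x : ℕ}, x < 16 → e x = 1 → x = 4 := fun hx h =>
    E.injective _ hx _ (by norm_num) (h.trans E.map_four.symm)
  by_cases h0 : π (a 0) = 0
  · by_cases h1 : π (a 1) = 0
    · have h2 : π (a 2) ≠ 0 := by
        obtain ⟨i, hi⟩ := ha
        fin_cases i
        exacts [absurd h0 hi, absurd h1 hi, hi]
      obtain ⟨c, hc, hc1, hc0, hca⟩ := key 2 h2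
      exact ⟨c, ⟨hc.1, hc.2.1, hc.2.2, Or.inr (Or.inr ⟨(E.mem_nu _ hc.1).1 (hc0 0 h0),
        (E.mem_nu _ hc.2.1).1 (hc0 1 h1), four hc.2.2 hc1⟩)⟩, hca⟩
    · obtain ⟨c, hc, hc1, hc0, hca⟩ := key 1 h1
      exact ⟨c, ⟨hc.1, hc.2.1, hc.2.2, Or.inr (Or.inl ⟨(E.mem_nu _ hc.1).1 (hc0 0 h0),
        four hc.2.1 hc1⟩)⟩, hca⟩
  · obtain ⟨c, hc, hc1, -, hca⟩ := key 0 h0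
    exact ⟨c, ⟨hc.1, hc.2.1, hc.2.2, Or.inl (four hc.1 hc1)⟩, hca⟩

theorem rowGood_of_isNormal {arc : List (ℕ × ℕ × ℕ)} (h : rowsGood add mul nu arc = true)
    {a : ℕ × ℕ × ℕ} (ha : IsNormal nu a) : rowGood add mul arc a = true := by
  simp only [rowsGood, Bool.and_eq_true, List.all_eq_true, List.mem_range] at h
  obtain ⟨x, y, z⟩ := a
  obtain ⟨hx, hy, hz, hn⟩ := ha
  simp only at hx hy hz hn
  rcases hn with rfl | ⟨hn, rfl⟩ | ⟨hn, hn', rfl⟩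
  · exact (h.1 z hz).1 y hy
  · exact (h.1 z hz).2 x hn
  · exact h.2 y hn' x hn

/-- A list of coded vectors which passes the numerical tests gives an arc. -/
theorem exists_arc (E : RingCode π e add mul nu) (h : IsUniformizer π θ)
    {arc : List (ℕ × ℕ × ℕ)} (hnodup : arc.Nodup) (hnormal : ∀ v ∈ arc, IsNormal nu v)
    (hgood : rowsGood add mul nu arc = true) :
    ∃ K : Finset (Point R), IsProjectiveArc arc.length 5 K := by
  classical
  have hn : ∀ v : arc.toFinset, IsNormal nu v.1 := fun v => hnormal v.1 (List.mem_toFinset.1 v.2)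
  let pt : arc.toFinset → Point R := fun v => ⟨Submodule.span Rᵐᵒᵖ {decodeVec e v.1}, by
    obtain ⟨i, hi⟩ := E.exists_ne_zero (hn v)
    exact h.isFreeOfRank_span hi⟩
  have hpt : Function.Injective pt := by
    intro v w hvw
    exact Subtype.ext (E.eq_of_span_eq (hn v) (hn w) (congrArg Subtype.val hvw))
  refine ⟨univ.map ⟨pt, hpt⟩, ?_, fun N => ?_⟩
  · rw [card_map, card_univ, Fintype.card_coe, List.toFinset_card_of_nodup hnodup]
  -- Containment of the line in the annihilator of a normalized row suffices, since only an upper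
  -- bound for its multiplicity is wanted.
  · obtain ⟨a, ha, hNa⟩ := h.exists_row N
    obtain ⟨c, hc, hac⟩ := E.exists_normal_row h ha
    have hg := rowGood_of_isNormal hgood hc
    rw [rowGood, Nat.ble_eq, List.countP_eq_length_filter] at hg
    refine le_trans ?_ ((List.toFinset_card_le _).trans hg)
    unfold lineMultiplicity
    rw [filter_map, card_map]
    refine card_le_card_of_injOn Subtype.val ?_ Subtype.val_injective.injOn
    intro v hv
    simp only [coe_filter, mem_univ, true_and, Set.mem_ofPred_eq, Function.comp_apply,
      Function.Embedding.coeFn_mk] at hv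
    have h1 : decodeVec e v.1 ∈ rowKer (decodeVec e c) :=
      hac (hNa (hv (Submodule.mem_span_singleton_self _)))
    have hc' := hc
    have hv' := hn v
    rw [mem_rowKer, ← E.map_codeDot ⟨hc.1, hc.2.1, hc.2.2.1⟩ ⟨hv'.1, hv'.2.1, hv'.2.2.1⟩] at h1
    rw [mem_coe, List.mem_toFinset, List.mem_filter]
    refine ⟨List.mem_toFinset.1 v.2, ?_⟩
    rw [Nat.beq_eq]
    exact E.eq_zero _ (E.add_lt _ _) h1

/-- In a plane with an arc of `68` points passing the numerical tests, `68` is the maximum. -/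
theorem m_eq_sixtyEight (E : RingCode π e add mul nu) (h : IsUniformizer π θ)
    (hk : Nat.card k = 4) {arc : List (ℕ × ℕ × ℕ)} (hlen : arc.length = 68)
    (hnodup : arc.Nodup) (hnormal : ∀ v ∈ arc, IsNormal nu v)
    (hgood : rowsGood add mul nu arc = true) : m 5 R = 68 := by
  classical
  have hub : ∀ n ∈ {n | ∃ K : Finset (Point R), IsProjectiveArc n 5 K}, n ≤ 68 := by
    rintro n ⟨K, rfl, hK⟩
    exact h.card_le_sixtyEight hk K hK
  have hmem := E.exists_arc h hnodup hnormal hgood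
  rw [hlen] at hmem
  exact IsGreatest.csSup_eq ⟨hmem, hub⟩

end RingCode

end Codes
end Hjelmslev

namespace Hjelmslev

/-! ### Coding of the field with four elements and of the rings with `X² = 0`. -/

section Rings

open Finset

/-- A binary operation on `{0, …, 15}` given by a table in base `16`. -/
def tableOp (T x y : ℕ) : ℕ := Nat.shiftRight T (4 * (16 * x + y)) % 16

theorem tableOp_lt (T x y : ℕ) : tableOp T x y < 16 := Nat.mod_lt _ (by norm_num)

theorem RingCode.isUniformizer {R k : Type*} [Ring R] [Field k] {π : R →+* k} {e : ℕ → R}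
    {add mul : ℕ → ℕ → ℕ} {nu : List ℕ} (E : RingCode π e add mul nu)
    (hπ : Function.Surjective π) {t : ℕ} (ht : t < 16 ∧ t ≠ 0 ∧ t ∈ nu)
    (hdiv : ∀ x ∈ nu, x < 16 → (∃ r < 16, mul t r = x) ∧ ∃ r < 16, mul r t = x)
    (hann : ∀ r < 16, (mul t r = 0 ↔ r ∈ nu) ∧ (mul r t = 0 ↔ r ∈ nu)) :
    IsUniformizer π (e t) where
  surjective := hπ
  ne_zero h := ht.2.1 (E.eq_zero t ht.1 h)
  map_eq_zero := (E.mem_nu t ht.1).2 ht.2.2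
  exists_right x hx := by
    obtain ⟨n, hn, rfl⟩ := E.surjective x
    obtain ⟨⟨r, hr, h⟩, -⟩ := hdiv n ((E.mem_nu n hn).1 hx) hn
    exact ⟨e r, by rw [← E.map_mul t ht.1 r hr, h]⟩
  exists_left x hx := by
    obtain ⟨n, hn, rfl⟩ := E.surjective x
    obtain ⟨-, r, hr, h⟩ := hdiv n ((E.mem_nu n hn).1 hx) hn
    exact ⟨e r, by rw [← E.map_mul r hr t ht.1, h]⟩
  mul_left_eq_zero r := by
    obtain ⟨n, hn, rfl⟩ := E.surjective r
    rw [E.mem_nu n hn, ← (hann n hn).1, ← E.map_mul t ht.1 n hn]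
    exact ⟨E.eq_zero _ (E.mul_lt _ _), fun h => by rw [h, E.map_zero]⟩
  mul_right_eq_zero r := by
    obtain ⟨n, hn, rfl⟩ := E.surjective r
    rw [E.mem_nu n hn, ← (hann n hn).2, ← E.map_mul n hn t ht.1]
    exact ⟨E.eq_zero _ (E.mul_lt _ _), fun h => by rw [h, E.map_zero]⟩

theorem card_F₄ : Nat.card F₄ = 4 := by
  rw [GaloisField.card 2 2 two_ne_zero]
  norm_num

theorem two_eq_zero_F₄ : (2 : F₄) = 0 := CharP.cast_eq_zero F₄ 2

theorem exists_omega : ∃ w : F₄, w ^ 2 + w + 1 = 0 := by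
  have : Fintype F₄ := Fintype.ofFinite _
  classical
  obtain ⟨w, -, hw⟩ : ∃ w ∈ (univ : Finset F₄), w ∉ ({0, 1} : Finset F₄) := by
    refine exists_mem_notMem_of_card_lt_card (lt_of_le_of_lt (card_le_two) ?_)
    rw [card_univ, ← Nat.card_eq_fintype_card, card_F₄]
    norm_num
  simp only [mem_insert, mem_singleton, not_or] at hw
  refine ⟨w, ?_⟩
  have h4 : w ^ 4 = w := by
    have := FiniteField.pow_card w
    rwa [← Nat.card_eq_fintype_card, card_F₄] at this
  -- The product is `w ^ 4 - w`.
  have h : w * (w - 1) * (w ^ 2 + w + 1) = 0 := by linear_combination h4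
  exact (mul_eq_zero.1 h).resolve_left (mul_ne_zero hw.1 (sub_ne_zero.2 hw.2))

/-- The elements `0, 1, w, w + 1` of `𝔽₄`. -/
noncomputable def codeF₄ (w : F₄) : ℕ → F₄
  | 0 => 0
  | 1 => 1
  | 2 => w
  | _ => w + 1

/-- The multiplication of `𝔽₄` on codes. -/
def mulF₄ (x y : ℕ) : ℕ := Nat.shiftRight 2625168384 (2 * (4 * x + y)) % 4

section

variable {w : F₄}

theorem codeF₄_xor : ∀ x < 4, ∀ y < 4, codeF₄ w (x ^^^ y) = codeF₄ w x + codeF₄ w y := by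
  have h2 := two_eq_zero_F₄
  intro x hx y hy
  interval_cases x <;> interval_cases y <;> simp [codeF₄] <;> grind

variable (hw : w ^ 2 + w + 1 = 0)
include hw

theorem codeF₄_mul : ∀ x < 4, ∀ y < 4, codeF₄ w (mulF₄ x y) = codeF₄ w x * codeF₄ w y := by
  have h2 := two_eq_zero_F₄
  intro x hx y hy
  interval_cases x <;> interval_cases y <;> simp [codeF₄, mulF₄] <;> grind

theorem codeF₄_eq_zero : ∀ x < 4, codeF₄ w x = 0 → x = 0 := by
  intro x hx h
  interval_cases x
  · rfl
  · exact absurd h one_ne_zero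
  · simp only [codeF₄] at h
    simp [h] at hw
  · simp only [codeF₄] at h
    rw [eq_neg_of_add_eq_zero_left h] at hw
    norm_num at hw

theorem codeF₄_injective : ∀ x < 4, ∀ y < 4, codeF₄ w x = codeF₄ w y → x = y := by
  intro x hx y hy h
  have h1 := codeF₄_xor (w := w) x hx y hy
  have h2 : codeF₄ w (x ^^^ y) = 0 := by
    rw [h1, h, ← two_mul, two_eq_zero_F₄, zero_mul]
  have h3 : x ^^^ y < 4 := Nat.xor_lt_two_pow (n := 2) hx hy
  exact Nat.xor_eq_zero_iff.1 (codeF₄_eq_zero hw _ h3 h2)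

theorem codeF₄_surjective (a : F₄) : ∃ x < 4, codeF₄ w x = a := by
  have : Fintype F₄ := Fintype.ofFinite _
  have h : Function.Bijective fun x : Fin 4 => codeF₄ w x := by
    rw [Fintype.bijective_iff_injective_and_card]
    refine ⟨fun x y hxy => Fin.ext (codeF₄_injective hw _ x.2 _ y.2 hxy), ?_⟩
    rw [← Nat.card_eq_fintype_card (α := F₄), card_F₄, Fintype.card_fin]
  obtain ⟨x, hx⟩ := h.2 a
  exact ⟨x, x.2, hx⟩

end

/-- `R` is the ring of the elements `a + b X` with `a, b ∈ 𝔽₄`, where `X² = 0` and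
`X a = τ(a) X`. -/
structure IsSkewDual {R : Type*} [Ring R] (ι : F₄ →+* R) (X : R) (τ : F₄ →+* F₄) : Prop where
  comm : ∀ a, X * ι a = ι (τ a) * X
  sq : X * X = 0
  repr : ∀ r, ∃ a b, r = ι a + ι b * X
  indep : ∀ a b, ι a + ι b * X = 0 → a = 0 ∧ b = 0

namespace IsSkewDual

variable {R : Type*} [Ring R] {ι : F₄ →+* R} {X : R} {τ : F₄ →+* F₄}

theorem unique (H : IsSkewDual ι X τ) {a b c d : F₄} (h : ι a + ι b * X = ι c + ι d * X) :
    a = c ∧ b = d := by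
  have := H.indep (a - c) (b - d) (by
    rw [map_sub, map_sub, sub_mul, ← sub_eq_zero.2 h]
    abel)
  exact ⟨sub_eq_zero.1 this.1, sub_eq_zero.1 this.2⟩

theorem mul_eq (H : IsSkewDual ι X τ) (a b c d : F₄) :
    (ι a + ι b * X) * (ι c + ι d * X) = ι (a * c) + ι (a * d + b * τ c) * X := by
  have h1 : ι b * X * ι c = ι (b * τ c) * X := by
    rw [mul_assoc, H.comm, ← mul_assoc, map_mul]
  have h2 : ι b * X * (ι d * X) = 0 := by
    rw [mul_assoc, ← mul_assoc X, H.comm, mul_assoc (ι (τ d)), H.sq, mul_zero, mul_zero]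
  rw [mul_add, add_mul, add_mul, h1, h2, map_add, add_mul, map_mul ι a c, map_mul ι a d]
  noncomm_ring

theorem exists_residue (H : IsSkewDual ι X τ) :
    ∃ π : R →+* F₄, ∀ a b, π (ι a + ι b * X) = a := by
  choose f g hfg using H.repr
  have hf : ∀ a b, f (ι a + ι b * X) = a := fun a b => ((H.unique (hfg _)).1).symm
  refine ⟨{ toFun := f, map_one' := ?_, map_mul' := ?_, map_zero' := ?_, map_add' := ?_ }, hf⟩
  · have := hf 1 0
    rwa [map_one, map_zero, zero_mul, add_zero] at this
  · intro r s
    conv_lhs => rw [hfg r, hfg s, H.mul_eq, hf]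
  · have := hf 0 0
    rwa [map_zero, zero_mul, add_zero] at this
  · intro r s
    have : r + s = ι (f r + f s) + ι (g r + g s) * X := by
      conv_lhs => rw [hfg r, hfg s]
      rw [map_add, map_add]
      noncomm_ring
    conv_lhs => rw [this, hf]

/-- The element `a + b X` has code `4 * a + b` in terms of the codes of `a` and `b`; the twist `τ`
acts on codes as `t`. The nonunits are the multiples of `X`, with codes 0 to 3. -/
theorem ringCode (H : IsSkewDual ι X τ) {w : F₄} (hw : w ^ 2 + w + 1 = 0) {A M : ℕ} {t : ℕ → ℕ}
    (ht : ∀ x < 4, t x < 4 ∧ τ (codeF₄ w x) = codeF₄ w (t x))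
    (hA : ∀ x < 16, ∀ y < 16, tableOp A x y = 4 * (x / 4 ^^^ y / 4) + (x % 4 ^^^ y % 4))
    (hM : ∀ x < 16, ∀ y < 16, tableOp M x y =
      4 * mulF₄ (x / 4) (y / 4) + (mulF₄ (x / 4) (y % 4) ^^^ mulF₄ (x % 4) (t (y / 4))))
    {π : R →+* F₄} (hπ : ∀ a b, π (ι a + ι b * X) = a) :
    RingCode π (fun x => ι (codeF₄ w (x / 4)) + ι (codeF₄ w (x % 4)) * X)
      (tableOp A) (tableOp M) [0, 1, 2, 3] := by
  have hlt : ∀ x < 16, x / 4 < 4 ∧ x % 4 < 4 := by omega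
  have hx : ∀ x < 4, ∀ y < 4, x ^^^ y < 4 := fun x h y h' => Nat.xor_lt_two_pow (n := 2) h h'
  have hm : ∀ x y, mulF₄ x y < 4 := fun x y => Nat.mod_lt _ (by norm_num)
  have hdm : ∀ x y, y < 4 → (4 * x + y) / 4 = x ∧ (4 * x + y) % 4 = y := by omega
  have hinj : ∀ x < 16, ∀ y < 16, ι (codeF₄ w (x / 4)) + ι (codeF₄ w (x % 4)) * X =
      ι (codeF₄ w (y / 4)) + ι (codeF₄ w (y % 4)) * X → x = y := by
    intro x hx y hy h
    obtain ⟨h1, h2⟩ := H.unique h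
    have h3 := codeF₄_injective hw _ (hlt x hx).1 _ (hlt y hy).1 h1
    have h4 := codeF₄_injective hw _ (hlt x hx).2 _ (hlt y hy).2 h2
    omega
  have h0 : ι (codeF₄ w (0 / 4)) + ι (codeF₄ w (0 % 4)) * X = 0 := by simp [codeF₄]
  refine ⟨tableOp_lt A, tableOp_lt M, ?_, ?_, h0, by simp [codeF₄], ?_, hinj, ?_, ?_⟩
  · intro x hx' y hy'
    obtain ⟨h1, h2⟩ := hlt x hx'
    obtain ⟨h3, h4⟩ := hlt y hy'
    obtain ⟨h5, h6⟩ := hdm (x / 4 ^^^ y / 4) _ (hx _ h2 _ h4)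
    rw [hA x hx' y hy', h5, h6, codeF₄_xor _ h1 _ h3, codeF₄_xor _ h2 _ h4, map_add,
      map_add]
    noncomm_ring
  · intro x hx' y hy'
    obtain ⟨h1, h2⟩ := hlt x hx'
    obtain ⟨h3, h4⟩ := hlt y hy'
    obtain ⟨h5, h6⟩ := hdm (mulF₄ (x / 4) (y / 4)) _
      (hx _ (hm (x / 4) (y % 4)) _ (hm (x % 4) (t (y / 4))))
    rw [hM x hx' y hy', h5, h6, H.mul_eq, codeF₄_xor _ (hm _ _) _ (hm _ _),
      codeF₄_mul hw _ h1 _ h3, codeF₄_mul hw _ h1 _ h4, codeF₄_mul hw _ h2 _ (ht _ h3).1,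
      (ht _ h3).2]
  · intro x hx' h
    exact hinj x hx' 0 (by norm_num) (h.trans h0.symm)
  · intro r
    obtain ⟨a, b, rfl⟩ := H.repr r
    obtain ⟨x, hx', rfl⟩ := codeF₄_surjective hw a
    obtain ⟨y, hy', rfl⟩ := codeF₄_surjective hw b
    obtain ⟨h1, h2⟩ := hdm x y hy'
    exact ⟨4 * x + y, by omega, by simp only [h1, h2]⟩
  · intro x hx'
    simp only [hπ, List.mem_cons, List.not_mem_nil, or_false]
    constructor
    · intro h
      have := codeF₄_eq_zero hw _ (hlt x hx').1 h
      omega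
    · intro h
      have : x / 4 = 0 := by omega
      rw [this]
      rfl

theorem residue_surjective {π : R →+* F₄} (hπ : ∀ a b, π (ι a + ι b * X) = a) :
    Function.Surjective π := fun a => ⟨_, hπ a 0⟩

end IsSkewDual

section AdjoinRoot

open Polynomial

variable {A : Type*} [CommRing A] {g : A[X]}

theorem adjoinRoot_repr (hg : g.Monic) (h2 : g.natDegree = 2) (r : AdjoinRoot g) :
    ∃ a b, r = AdjoinRoot.of g a + AdjoinRoot.of g b * AdjoinRoot.root g := by
  obtain ⟨p, rfl⟩ := AdjoinRoot.mk_surjective r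
  have h1 : (p %ₘ g).natDegree ≤ 1 := by
    have := natDegree_modByMonic_lt p hg (by rintro rfl; simp at h2)
    omega
  obtain ⟨b, a, hab⟩ := exists_eq_X_add_C_of_natDegree_le_one h1
  refine ⟨a, b, ?_⟩
  have h3 : AdjoinRoot.mk g p = AdjoinRoot.mk g (p %ₘ g) := by
    rw [AdjoinRoot.mk_eq_mk]
    exact ⟨p /ₘ g, by rw [eq_comm, ← sub_eq_iff_eq_add'.2 (modByMonic_add_div p g).symm]⟩
  rw [h3, hab, map_add, map_mul, AdjoinRoot.mk_C, AdjoinRoot.mk_C, AdjoinRoot.mk_X, add_comm]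

theorem adjoinRoot_indep (hg : g.Monic) (h2 : g.natDegree = 2) {a b : A}
    (h : AdjoinRoot.of g a + AdjoinRoot.of g b * AdjoinRoot.root g = 0) : a = 0 ∧ b = 0 := by
  rw [← AdjoinRoot.mk_X, ← AdjoinRoot.mk_C, ← AdjoinRoot.mk_C, ← map_mul, ← map_add,
    AdjoinRoot.mk_eq_zero] at h
  have h0 : C a + C b * X = 0 := by
    by_contra hne
    refine hg.not_dvd_of_natDegree_lt hne ?_ h
    rw [h2]
    refine lt_of_le_of_lt (b := 1) ?_ (by norm_num)
    compute_degree
  have ha := congrArg (coeff · 0) h0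
  have hb := congrArg (coeff · 1) h0
  simp at ha hb
  exact ⟨ha, hb⟩

end AdjoinRoot

theorem isSkewDual_S₄ : IsSkewDual (AdjoinRoot.of (Polynomial.X ^ 2 : F₄[X]))
    (AdjoinRoot.root (Polynomial.X ^ 2 : F₄[X])) (RingHom.id F₄) where
  comm a := by rw [mul_comm]; rfl
  sq := by
    rw [← AdjoinRoot.mk_X, ← map_mul, ← sq, AdjoinRoot.mk_self]
  repr := adjoinRoot_repr (Polynomial.monic_X_pow 2) (Polynomial.natDegree_X_pow 2)
  indep _ _ := adjoinRoot_indep (Polynomial.monic_X_pow 2) (Polynomial.natDegree_X_pow 2)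

end Rings
end Hjelmslev

namespace Hjelmslev

/-! ### The skew polynomial quotient and the Galois ring. -/

section Rings

open Matrix SkewPolynomial

/-- A ring homomorphism from `𝔽₄` and an element obeying the rule `X a = a² X` extend to the skew
polynomial ring. -/
theorem exists_lift {S : Type*} [Semiring S] (f : F₄ →+* S) (E : S)
    (h : ∀ a, f (a ^ 2) * E = E * f a) :
    ∃ ρ : SkewPolynomial F₄ →+* S, (∀ a, ρ (C a) = f a) ∧ ρ X = E := by
  have hg : ∀ n : ℕ, powersHom S E (Multiplicative.ofAdd n) = E ^ n := fun n => rfl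
  have hcomm : ∀ {x : F₄} {y : Multiplicative ℕ},
      f (y • x) * powersHom S E y = powersHom S E y * f x := by
    intro x y
    induction y using Multiplicative.rec with | _ n
    induction n generalizing x with
    | zero => simp
    | succ n ih =>
      have h1 : Multiplicative.ofAdd (n + 1) • x = Multiplicative.ofAdd n • (x ^ 2) :=
        mul_smul (Multiplicative.ofAdd n) (Multiplicative.ofAdd 1) x
      rw [hg] at ih
      rw [h1, hg, pow_succ E n, ← mul_assoc, ih, mul_assoc, mul_assoc, h]
  refine ⟨SkewMonoidAlgebra.liftNCRingHom f (powersHom S E) hcomm, fun a => ?_, ?_⟩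
  · refine (SkewMonoidAlgebra.liftNC_single (f : F₄ →+ S) (powersHom S E) 1 a).trans ?_
    rw [map_one, mul_one]
    rfl
  · refine (SkewMonoidAlgebra.liftNC_single (f : F₄ →+ S) (powersHom S E)
      (Multiplicative.ofAdd 1) 1).trans ?_
    rw [hg, pow_one]
    change f 1 * E = E
    rw [map_one, one_mul]

/-- The representation `a ↦ diag(a, a²)`, `X ↦ E₀₁` of the skew polynomial ring. -/
theorem exists_matrix_representation : ∃ ρ : SkewPolynomial F₄ →+* Matrix (Fin 2) (Fin 2) F₄,
    (∀ a, ρ (C a) = !![a, 0; 0, a ^ 2]) ∧ ρ X = !![0, 1; 0, 0] := by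
  let f : F₄ →+* Matrix (Fin 2) (Fin 2) F₄ :=
    (diagonalRingHom (Fin 2) F₄).comp (RingHom.pi ![RingHom.id F₄, frobenius F₄ 2])
  have hf : ∀ a, f a = !![a, 0; 0, a ^ 2] := by
    intro a
    change diagonal (fun i => (![RingHom.id F₄, frobenius F₄ 2] i) a) = _
    ext i j
    fin_cases i <;> fin_cases j <;> simp [frobenius_def]
  obtain ⟨ρ, hC, hX⟩ := exists_lift f !![0, 1; 0, 0] (fun a => by
    rw [hf, hf]
    simp)
  exact ⟨ρ, fun a => (hC a).trans (hf a), hX⟩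

/-- The quotient map onto `T₄`. -/
noncomputable def toT₄ : SkewPolynomial F₄ →+* T₄ := RingCon.mk' _

theorem toT₄_surjective : Function.Surjective toT₄ := RingCon.mk'_surjective _

theorem toT₄_X_sq : toT₄ X * toT₄ X = 0 := by
  rw [← map_mul, ← sq, ← TwoSidedIdeal.mem_ker]
  unfold toT₄
  rw [TwoSidedIdeal.ker_ringCon_mk']
  exact TwoSidedIdeal.subset_span rfl

theorem isSkewDual_T₄ : IsSkewDual (toT₄.comp CRingHom) (toT₄ X) (frobenius F₄ 2) where
  comm a := by
    have := congrArg toT₄ (Hjelmslev.X_mul_C a)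
    rwa [map_mul, map_mul] at this
  sq := toT₄_X_sq
  repr r := by
    obtain ⟨p, rfl⟩ := toT₄_surjective r
    induction p using SkewPolynomial.induction with
    | h0 => exact ⟨0, 0, by simp⟩
    | ha n r q _ _ ih =>
      obtain ⟨a, b, h⟩ := ih
      rw [map_add, h, ← C_mul_X_pow_eq_monomial, map_mul, map_pow]
      rcases n with _ | _ | n
      · refine ⟨r + a, b, ?_⟩
        rw [pow_zero, mul_one, map_add, add_assoc]
        rfl
      · refine ⟨a, r + b, ?_⟩
        rw [zero_add, pow_one, map_add, add_mul, add_left_comm]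
        rfl
      · refine ⟨a, b, ?_⟩
        rw [pow_add, pow_add, pow_one, mul_assoc (toT₄ X ^ n), toT₄_X_sq, mul_zero, mul_zero,
          zero_add]
  -- The matrix representation kills `X ^ 2`, hence the whole ideal, but sends `a + b X` to a matrix
  -- with first row `(a, b)`. So no nonzero such element lies in the ideal.
  indep a b h := by
    obtain ⟨ρ, hC, hX⟩ := exists_matrix_representation
    have h1 : C a + C b * X ∈
        TwoSidedIdeal.span {(X ^ 2 : SkewPolynomial F₄)} := by
      rw [← TwoSidedIdeal.ker_ringCon_mk' (TwoSidedIdeal.span _), TwoSidedIdeal.mem_ker, map_add,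
        map_mul]
      exact h
    have h2 : TwoSidedIdeal.span {(X ^ 2 : SkewPolynomial F₄)} ≤ TwoSidedIdeal.ker ρ := by
      rw [TwoSidedIdeal.span_le, Set.singleton_subset_iff, SetLike.mem_coe, TwoSidedIdeal.mem_ker,
        map_pow, hX]
      ext i j
      fin_cases i <;> fin_cases j <;> simp [sq]
    have h3 := (TwoSidedIdeal.mem_ker ρ).1 (h2 h1)
    rw [map_add, map_mul, hC, hC, hX] at h3
    exact ⟨by simpa using congrFun (congrFun h3 0) 0, by simpa using congrFun (congrFun h3 0) 1⟩

/-- The class of `X` in `G₄`. -/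
noncomputable def rootG₄ : G₄ := AdjoinRoot.root _

/-- The element of `G₄` with code `x`. -/
noncomputable def codeG₄ (x : ℕ) : G₄ :=
  ((x / 4 : ℕ) : G₄) + ((x % 4 : ℕ) : G₄) * rootG₄

theorem four_eq_zero_G₄ : (4 : G₄) = 0 := by
  have : AdjoinRoot.of (Polynomial.X ^ 2 + Polynomial.X + 1 : (ZMod 4)[X]) (4 : ℕ) = 0 := by
    rw [show ((4 : ℕ) : ZMod 4) = 0 from rfl, map_zero]
  rw [map_natCast] at this
  exact_mod_cast this

theorem rootG₄_eq : rootG₄ ^ 2 + rootG₄ + 1 = 0 := by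
  have := AdjoinRoot.mk_self (f := (Polynomial.X ^ 2 + Polynomial.X + 1 : (ZMod 4)[X]))
  rwa [map_add, map_add, map_pow, map_one] at this

theorem natCast_mod_four (n : ℕ) : ((n % 4 : ℕ) : G₄) = n := by
  conv_rhs => rw [← Nat.div_add_mod n 4]
  push_cast
  rw [four_eq_zero_G₄, zero_mul, zero_add]

instance : Fact (1 < 4) := ⟨by norm_num⟩

theorem natDegree_G₄ : (Polynomial.X ^ 2 + Polynomial.X + 1 : (ZMod 4)[X]).natDegree = 2 := by
  compute_degree!

theorem monic_G₄ : (Polynomial.X ^ 2 + Polynomial.X + 1 : (ZMod 4)[X]).Monic := by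
  monicity!

theorem exists_residue_G₄ {w : F₄} (hw : w ^ 2 + w + 1 = 0) : ∃ π : G₄ →+* F₄,
    Function.Surjective π ∧ ∀ x < 16, π (codeG₄ x) = 0 ↔ x ∈ [0, 2, 8, 10] := by
  have h2 := two_eq_zero_F₄
  have h10 : (1 : F₄) ≠ 0 := one_ne_zero
  let π : G₄ →+* F₄ := AdjoinRoot.lift (ZMod.castHom (show 2 ∣ 4 by norm_num) F₄) w (by
    simpa using hw)
  have hπ : ∀ x, π (codeG₄ x) = (x / 4 : ℕ) + (x % 4 : ℕ) * w := by
    intro x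
    simp [codeG₄, rootG₄, π]
  refine ⟨π, fun a => ?_, fun x hx => ?_⟩
  · obtain ⟨x, hx, rfl⟩ := codeF₄_surjective hw a
    -- The code of an element of the residue field is binary in the basis `1, w`, while `codeG₄`
    -- puts the coefficient of 1 in the higher digit.
    refine ⟨codeG₄ ((x % 2) * 4 + x / 2), ?_⟩
    rw [hπ]
    interval_cases x <;> simp [codeF₄, add_comm]
  · rw [hπ]
    interval_cases x <;> simp <;> grind

theorem ringCode_G₄ {A M : ℕ}
    (hA : ∀ x < 16, ∀ y < 16,
      tableOp A x y = 4 * ((x / 4 + y / 4) % 4) + (x % 4 + y % 4) % 4)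
    (hM : ∀ x < 16, ∀ y < 16, tableOp M x y =
      4 * ((x / 4 * (y / 4) + 3 * (x % 4 * (y % 4))) % 4) +
        (x / 4 * (y % 4) + x % 4 * (y / 4) + 3 * (x % 4 * (y % 4))) % 4)
    {π : G₄ →+* F₄} (hπ : ∀ x < 16, π (codeG₄ x) = 0 ↔ x ∈ [0, 2, 8, 10]) :
    RingCode π codeG₄ (tableOp A) (tableOp M) [0, 2, 8, 10] := by
  have hdm : ∀ x y, (4 * (x % 4) + y % 4) / 4 = x % 4 ∧ (4 * (x % 4) + y % 4) % 4 = y % 4 := by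
    omega
  have hcode : ∀ x y, codeG₄ (4 * (x % 4) + y % 4) = (x : G₄) + y * rootG₄ := by
    intro x y
    rw [codeG₄, (hdm x y).1, (hdm x y).2, natCast_mod_four, natCast_mod_four]
  have h4 := four_eq_zero_G₄
  have hr := rootG₄_eq
  have hadd : ∀ x < 16, ∀ y < 16, codeG₄ (tableOp A x y) = codeG₄ x + codeG₄ y := by
    intro x hx y hy
    rw [hA x hx y hy, hcode, codeG₄, codeG₄]
    push_cast
    ring
  have hzero : ∀ x < 16, codeG₄ x = 0 → x = 0 := by
    intro x hx h
    have h1 := adjoinRoot_indep monic_G₄ natDegree_G₄ (a := (x / 4 : ℕ)) (b := (x % 4 : ℕ)) (by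
      rw [map_natCast, map_natCast]
      exact h)
    rw [ZMod.natCast_eq_zero_iff, ZMod.natCast_eq_zero_iff] at h1
    omega
  refine ⟨tableOp_lt A, tableOp_lt M, hadd, ?_, by simp [codeG₄], by simp [codeG₄], hzero, ?_, ?_,
    hπ⟩
  · intro x hx y hy
    rw [hM x hx y hy, hcode, codeG₄, codeG₄]
    generalize x / 4 = a, x % 4 = b, y / 4 = c, y % 4 = d
    push_cast
    -- The square of the root is `-1` minus the root; the coefficient 3 in the table stands for
    -- `-1`, hence the use of `4 = 0`.
    linear_combination (b * d : G₄) * (1 + rootG₄) * h4 - (b * d : G₄) * hr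
  · intro x hx y hy h
    -- Every code has a negative, and it determines the code; this reduces injectivity to the
    -- triviality of the kernel.
    have h1 : ∀ x < 16, ∃ y < 16, tableOp A x y = 0 ∧
        ∀ z < 16, tableOp A z y = 0 → z = x := by
      intro x hx
      refine ⟨4 * ((4 - x / 4) % 4) + (4 - x % 4) % 4, by omega, ?_, fun z hz h => ?_⟩
      · rw [hA _ hx _ (by omega)]
        omega
      · rw [hA _ hz _ (by omega)] at h
        omega
    obtain ⟨z, hz, h2, h3⟩ := h1 y hy
    refine h3 x hx (hzero _ (tableOp_lt _ _ _) ?_)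
    rw [hadd x hx z hz, h, ← hadd y hy z hz, h2]
    simp [codeG₄]
  · intro r
    obtain ⟨a, b, rfl⟩ := adjoinRoot_repr monic_G₄ natDegree_G₄ r
    refine ⟨4 * (a.val % 4) + b.val % 4, by omega, ?_⟩
    rw [hcode, ← map_natCast (AdjoinRoot.of _) a.val, ← map_natCast (AdjoinRoot.of _) b.val,
      ZMod.natCast_zmod_val, ZMod.natCast_zmod_val]
    rfl

end Rings
end Hjelmslev

namespace Hjelmslev

/-! ### The explicit tables and arcs for the three rings. -/

section Arcs

/-- The addition table of `ℤ₄[X]/(X² + X + 1)`. -/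
def g4Add : ℕ :=
  119058206679779629989502752678334176498911652873975212952642891705572099328516938190838695845514798047134537603003086342837446664555427968498665379511991409241884264381563720044777287027923944351074518116923704918686356811529308109379642594282408971946062458936134474217286510114536015771699417078923615547920

/-- The multiplication table of `ℤ₄[X]/(X² + X + 1)`. -/
def g4Mul : ℕ :=
  20774268689141803618368932699636895341928338412098771342226636419732851249160488406073820644787174131042721799060481643617444526736029818893878624128352154767926038553242851215131852975535805933933179163490644416413283530978104780667411803857910611316082331345148538310327182430486857712049848454802917294080

/-- The addition table of `𝔽₄[X]/(X²)` and of `𝔽₄[X; a ↦ a²]/(X²)`. -/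
def s4Add : ℕ :=
  798974726605473726946832238011593618400339158202517049033210936078539962612148351302787556971974837864606271200763683943951953866025539096785282858647326000342156170857478456413950631519959977197563975844721619162716127815821009475742892049151496040916675244806998969647283770674449648040311876430683451920

/-- The multiplication table of `𝔽₄[X]/(X²)`. -/
def s4Mul : ℕ :=
  98032798199124179076956663395971488186128396494440331759750832126615350720588674807897072024178611706921324230098891034313136765948385774420598743647648983322538701622931120408135217888060019660276066888148759173860627771636263157436870178023803055442334248042821479801919559213667352410067208809325036306432

/-- The multiplication table of `𝔽₄[X; a ↦ a²]/(X²)`. -/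
def t4Mul : ℕ :=
  129673535959181470212990868022817095965945099291351006893742741575194800292132653819677246023517985699759382356747426316084207340244643186961659957500057664920317283002075110604689935324917035969216937524670039136500063766811959674242839909122178644348992479370068967547519317634295179812688748093162685202432

/-- A projective `(68, 5)`-arc over `G₄`. -/
def g4Arc : List (ℕ × ℕ × ℕ) :=
  [(0, 0, 4), (0, 4, 7), (0, 4, 8), (0, 4, 13), (0, 8, 4), (2, 2, 4), (2, 4, 0), (2, 4, 6), (2,
    4, 12), (2, 10, 4), (4, 0, 2), (4, 0, 6), (4, 0, 11), (4, 0, 15), (4, 1, 8), (4, 1, 10), (4,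
    1, 11), (4, 2, 1), (4, 2, 8), (4, 2, 14), (4, 2, 15), (4, 3, 1), (4, 3, 4), (4, 3, 6), (4,
    4, 0), (4, 4, 2), (4, 4, 13), (4, 5, 7), (4, 5, 8), (4, 5, 10), (4, 5, 13), (4, 6, 4), (4,
    6, 6), (4, 6, 13), (4, 8, 0), (4, 8, 1), (4, 8, 4), (4, 8, 7), (4, 9, 0), (4, 9, 1), (4, 9,
    2), (4, 10, 7), (4, 10, 10), (4, 10, 11), (4, 10, 12), (4, 11, 4), (4, 11, 6), (4, 11, 11),
    (4, 12, 5), (4, 12, 8), (4, 12, 10), (4, 13, 0), (4, 13, 2), (4, 13, 3), (4, 13, 11), (4,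
    14, 4), (4, 14, 5), (4, 14, 6), (4, 15, 1), (4, 15, 5), (4, 15, 9), (4, 15, 15), (8, 4, 4),
    (8, 4, 10), (8, 4, 14), (10, 4, 2), (10, 4, 5), (10, 4, 15)]

/-- A projective `(68, 5)`-arc over `S₄`. -/
def s4Arc : List (ℕ × ℕ × ℕ) :=
  [(0, 4, 5), (1, 1, 4), (1, 2, 4), (1, 4, 6), (1, 4, 8), (1, 4, 11), (1, 4, 13), (1, 4, 14),
    (2, 4, 5), (3, 0, 4), (3, 3, 4), (3, 4, 6), (3, 4, 9), (3, 4, 10), (3, 4, 12), (3, 4, 15),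
    (4, 0, 3), (4, 0, 4), (4, 0, 9), (4, 0, 13), (4, 1, 3), (4, 1, 7), (4, 1, 9), (4, 1, 15),
    (4, 2, 2), (4, 2, 4), (4, 2, 9), (4, 2, 15), (4, 3, 2), (4, 3, 7), (4, 3, 9), (4, 3, 13),
    (4, 4, 2), (4, 4, 6), (4, 4, 7), (4, 5, 1), (4, 5, 6), (4, 5, 7), (4, 6, 2), (4, 6, 12), (4,
    6, 13), (4, 7, 1), (4, 7, 14), (4, 7, 15), (4, 8, 2), (4, 8, 3), (4, 8, 13), (4, 8, 14), (4,
    9, 0), (4, 9, 1), (4, 9, 4), (4, 9, 6), (4, 10, 4), (4, 10, 6), (4, 10, 13), (4, 10, 14),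
    (4, 12, 3), (4, 12, 6), (4, 12, 7), (4, 12, 14), (4, 12, 15), (4, 13, 1), (4, 13, 4), (4,
    13, 5), (4, 13, 14), (4, 13, 15), (4, 14, 1), (4, 15, 3)]

/-- A projective `(68, 5)`-arc over `T₄`. -/
def t4Arc : List (ℕ × ℕ × ℕ) :=
  [(0, 0, 4), (0, 3, 4), (0, 4, 5), (0, 4, 10), (0, 4, 11), (1, 4, 6), (1, 4, 12), (1, 4, 13),
    (2, 4, 6), (2, 4, 12), (2, 4, 13), (3, 1, 4), (3, 2, 4), (3, 4, 5), (3, 4, 8), (3, 4, 9),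
    (4, 0, 4), (4, 0, 7), (4, 0, 14), (4, 0, 15), (4, 2, 10), (4, 2, 11), (4, 2, 12), (4, 2,
    13), (4, 3, 5), (4, 3, 6), (4, 3, 10), (4, 3, 11), (4, 4, 0), (4, 4, 6), (4, 4, 11), (4, 4,
    14), (4, 5, 0), (4, 5, 5), (4, 5, 9), (4, 5, 14), (4, 6, 0), (4, 6, 5), (4, 6, 11), (4, 6,
    12), (4, 7, 0), (4, 7, 6), (4, 7, 9), (4, 7, 12), (4, 8, 6), (4, 8, 7), (4, 8, 12), (4, 9,
    6), (4, 9, 7), (4, 9, 15), (4, 10, 8), (4, 10, 11), (4, 10, 15), (4, 11, 9), (4, 11, 10),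
    (4, 11, 12), (4, 12, 5), (4, 12, 7), (4, 12, 14), (4, 13, 5), (4, 13, 7), (4, 13, 15), (4,
    14, 9), (4, 14, 10), (4, 14, 15), (4, 15, 9), (4, 15, 10), (4, 15, 14)]

theorem m_five_G₄ : m 5 G₄ = 68 := by
  obtain ⟨w, hw⟩ := exists_omega
  obtain ⟨π, hπ, hnu⟩ := exists_residue_G₄ hw
  have E : RingCode π codeG₄ (tableOp g4Add) (tableOp g4Mul) [0, 2, 8, 10] :=
    ringCode_G₄ (by decide +kernel) (by decide +kernel) hnu
  -- Code 8 is the element 2, which generates the radical of the Galois ring.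
  exact E.m_eq_sixtyEight (E.isUniformizer hπ (t := 8) (by decide +kernel) (by decide +kernel)
    (by decide +kernel)) card_F₄ (arc := g4Arc) rfl (by decide +kernel) (by decide +kernel)
    (by decide +kernel)

theorem IsSkewDual.m_five {R : Type*} [Ring R] {ι : F₄ →+* R} {X : R} {τ : F₄ →+* F₄}
    (H : IsSkewDual ι X τ) {w : F₄} (hw : w ^ 2 + w + 1 = 0) {A M : ℕ} {t : ℕ → ℕ}
    (ht : ∀ x < 4, t x < 4 ∧ τ (codeF₄ w x) = codeF₄ w (t x))
    (hA : ∀ x < 16, ∀ y < 16, tableOp A x y = 4 * (x / 4 ^^^ y / 4) + (x % 4 ^^^ y % 4))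
    (hM : ∀ x < 16, ∀ y < 16, tableOp M x y =
      4 * mulF₄ (x / 4) (y / 4) + (mulF₄ (x / 4) (y % 4) ^^^ mulF₄ (x % 4) (t (y / 4))))
    (hdiv : ∀ x ∈ [0, 1, 2, 3], x < 16 →
      (∃ r < 16, tableOp M 1 r = x) ∧ ∃ r < 16, tableOp M r 1 = x)
    (hann : ∀ r < 16, (tableOp M 1 r = 0 ↔ r ∈ [0, 1, 2, 3]) ∧
      (tableOp M r 1 = 0 ↔ r ∈ [0, 1, 2, 3]))
    {arc : List (ℕ × ℕ × ℕ)} (hlen : arc.length = 68) (hnodup : arc.Nodup)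
    (hnormal : ∀ v ∈ arc, IsNormal [0, 1, 2, 3] v)
    (hgood : rowsGood (tableOp A) (tableOp M) [0, 1, 2, 3] arc = true) : m 5 R = 68 := by
  obtain ⟨π, hπ⟩ := H.exists_residue
  have E := H.ringCode hw ht hA hM hπ
  -- Code 1 is the element `X`.
  exact E.m_eq_sixtyEight (E.isUniformizer (residue_surjective hπ) (t := 1) (by decide) hdiv hann)
    card_F₄ hlen hnodup hnormal hgood

theorem m_five_S₄ : m 5 S₄ = 68 := by
  obtain ⟨w, hw⟩ := exists_omega
  exact isSkewDual_S₄.m_five hw (A := s4Add) (M := s4Mul) (t := id) (arc := s4Arc)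
    (fun x hx => ⟨hx, rfl⟩) (by decide +kernel) (by decide +kernel) (by decide +kernel)
    (by decide +kernel) rfl (by decide +kernel) (by decide +kernel) (by decide +kernel)

theorem m_five_T₄ : m 5 T₄ = 68 := by
  obtain ⟨w, hw⟩ := exists_omega
  have h2 := two_eq_zero_F₄
  refine isSkewDual_T₄.m_five hw (A := s4Add) (M := t4Mul) (t := fun x => mulF₄ x x)
    (arc := t4Arc) (fun x hx => ⟨Nat.mod_lt _ (by norm_num), ?_⟩) (by decide +kernel)
    (by decide +kernel) (by decide +kernel) (by decide +kernel) rfl (by decide +kernel)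
    (by decide +kernel) (by decide +kernel)
  rw [frobenius_def, sq, codeF₄_mul hw x hx x hx]

end Arcs
end Hjelmslev

theorem mainTheorem9 :
    Hjelmslev.m 5 Hjelmslev.G₄ = 68 ∧ Hjelmslev.m 5 Hjelmslev.S₄ = 68 ∧
      Hjelmslev.m 5 Hjelmslev.T₄ = 68 :=
  ⟨Hjelmslev.m_five_G₄, Hjelmslev.m_five_S₄, Hjelmslev.m_five_T₄⟩
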